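/- **Problem.** Let $\mathcal P$ be a nonempty finite set of processors and $\mathcal J$ a nonempty finite set of jobs with weights $w_j\ge 0$. Job $j$ has $r_j\ge 1$ rounds; every round consists of at least one map task and at least one reduce task, and $\mathcal T$ is the finite set of all tasks. Task $T_{k,j}$ of job $j$ has processing time $p_{i,k,j}\ge 1$ on processor $i$ (for example, positive integers). Within each job, every map task of a round precedes every reduce task of the same round, and every reduce task of a round precedes every map task of the next round; these pairs $T_{k',j}\prec T_{k,j}$ are the edges of the precedence graph. A schedule assigns to every task a processor and a starting time $\ge 0$; tasks are not preempted, a task starts only after all its predecessors are completed, and a processor executes at most one task at a time. The completion time $C_j$ of a job is that of its last finishing task, and the goal is to minimize $\sum_j w_jC_j$. Let $\mathrm{OPT}$ be the optimal value, $l_{\max}$ the maximum number of edges of a directed path in the precedence graph, and $r_{\max}=\max_j r_j$. **Linear program (LP3).** Let $\delta>0$, $t_{\max}=\sum_{T_{k,j}\in\mathcal T}\max_i p_{i,k,j}$, let $L$ be the smallest integer with $(1+\delta)^{L-1}\ge t_{\max}$, and $\mathcal L=\{1,\dots,L\}$. Minimize $\sum_j w_jC_j$ over real $C_j$, $C_{k,j}$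 and $y_{i,k,j,\ell}\ge 0$ subject to - $\sum_{i}\sum_{\ell\in\mathcal L} y_{i,k,j,\ell}\ge 1$ and $C_j\ge C_{k,j}$ for all $T_{k,j}$; - $C_{k,j}\ge C_{k',j}+\sum_i p_{i,k,j}\sum_{\ell\in\mathcal L} y_{i,k,j,\ell}$ whenever $T_{k',j}\prec T_{k,j}$; - $\sum_i\sum_{\ell\in\mathcal L}(1+\delta)^{\ell-1}y_{i,k,j,\ell}\le C_{k,j}$ for all $T_{k,j}$; - $\sum_{T_{k,j}\in\mathcal T} p_{i,k,j}\sum_{t\le \ell}y_{i,k,j,t}\le(1+\delta)^\ell$ for all $i\in\mathcal P$, $\ell\in\mathcal L$; - $y_{i,k,j,\ell}=0$ whenever $p_{i,k,j}>(1+\delta)^\ell$. **Algorithm Multi-round MRS** (with constants $\alpha>1$, $\delta>0$). 1. Compute an optimal solution $(\bar y,\bar C)$ of (LP3). 2. For $\ell\ge1$ let $S(\ell)=\{T_{k,j} : (1+\delta)^{\ell-1}\le\alpha\bar C_{k,j}<(1+\delta)^\ell\}$. 3. Decompose each $S(\ell)$ into levels $V_{1,\ell},V_{2,\ell},\dots$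 by repeatedly removing all tasks that have no predecessor among the remaining tasks of $S(\ell)$; $V_{t,\ell}$ is the set removed in step $t$. 4. Go through the levels in increasing order of $\ell$ and, for each $\ell$, of $t$. Assign the tasks of $V_{t,\ell}$ to processors by Shmoys–Tardos rounding of the fractional assignment $$x_{i,k,j}=\frac{\sum_{t'\in\mathcal L,\,t'\le\ell}\bar y_{i,k,j,t'}}{\sum_{i'}\sum_{t'\in\mathcal L,\,t'\le\ell}\bar y_{i',k,j,t'}}.$$ That is: on each processor, lay out the fractions of the tasks of $V_{t,\ell}$ consecutively on the half-line $[0,\infty)$ in order of non-increasing processing time, ties broken arbitrarily; cut the half-line into unit slots; join a task to a slot if a positive part of its fraction lies in that slot; and assign the tasks according to an arbitrary matching of tasks to slots that covers all tasks of $V_{t,\ell}$. Then place the tasks of $V_{t,\ell}$ one by one, in any order, each non-preemptively at the earliest time on its processor that is compatible with its precedences and with the tasks already placed. **Theorem.** Let $\alpha>1$ and $\delta>0$. Then (LP3) has an optimal solution, and from every optimal solution the algorithm can be carried out. Whatever optimal solution is used and whichever arbitrary choices are made, the resulting schedule is feasible and its total weighted completion time is at most $\rho\cdot\mathrm{OPT}$,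 where $$\rho=\alpha\left[(l_{\max}+1)\frac{\alpha}{\alpha-1}+l_{\max}\frac{\alpha}{\delta(\alpha-1)}+l_{\max}+1+\frac{l_{\max}+1}{\delta}\right](1+\delta).$$ Moreover $l_{\max}=2r_{\max}-1$, and there is a constant $K>0$ depending only on $\alpha$ and $\delta$ such that $\rho\le K\,l_{\max}$ and $\rho\le K\,r_{\max}$; thus the algorithm is an $O(l_{\max})=O(r_{\max})$-approximation. -/

import Mathlib

open Finset
open scoped BigOperators Classical

namespace MapReduce

noncomputable section

/-- An instance of multi-round MapReduce scheduling on unrelated processors: `P` is the set of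
processors, `J` the set of jobs and `T` the set of all (map and reduce) tasks.  Job `j` has
`rounds j ≥ 1` rounds, numbered from `1`; each round has at least one map task and at least one
reduce task.  `p i k` is the processing time of task `k` on processor `i`; the time unit is such
that every processing time is at least `1` (e.g. positive integers). -/
structure Instance (P J T : Type*) where
  rounds : J → ℕ
  one_le_rounds : ∀ j, 1 ≤ rounds j
  job : T → J
  round : T → ℕ
  isReduce : T → Bool
  one_le_round : ∀ k, 1 ≤ round k
  round_le : ∀ k, round k ≤ rounds (job k)
  exists_task : ∀ j q b, 1 ≤ q → q ≤ rounds j → ∃ k, job k = j ∧ round k = q ∧ isReduce k = b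
  p : P → T → ℝ
  one_le_p : ∀ i k, 1 ≤ p i k
  w : J → ℝ
  w_nonneg : ∀ j, 0 ≤ w j

/-- A non-preemptive schedule: a processor and a starting time for every task. -/
structure Schedule (P T : Type*) where
  proc : T → P
  start : T → ℝ

/-- Values for the variables `y i k ℓ`, `C_k` (tasks) and `C_j` (jobs) of the linear program.
Only the values `y i k ℓ` with `1 ≤ ℓ ≤ L` are ever used. -/
structure LPSolution (P J T : Type*) where
  y : P → T → ℕ → ℝ
  Ctask : T → ℝ
  Cjob : J → ℝ

namespace Instance

variable {P J T : Type*} (I : Instance P J T)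

/-- The edges `k' ≺ k` of the precedence graph: within a job, every map task of a round precedes
every reduce task of that round, which precedes every map task of the next round. -/
def Prec (k' k : T) : Prop :=
  I.job k' = I.job k ∧
    ((I.isReduce k' = false ∧ I.isReduce k = true ∧ I.round k = I.round k') ∨
     (I.isReduce k' = true ∧ I.isReduce k = false ∧ I.round k = I.round k' + 1))

/-- The maximum number of edges of a directed path in the precedence graph. -/
def lmax : ℕ :=
  sSup {n | ∃ path : List T, path.IsChain I.Prec ∧ path.length = n + 1}

/-- The maximum number of rounds of a job. -/
def rmax [Fintype J] : ℕ := univ.sup I.rounds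

/-! ### Schedules and their cost -/

/-- The completion time of a task in a schedule. -/
def completion (σ : Schedule P T) (k : T) : ℝ := σ.start k + I.p (σ.proc k) k

/-- Feasibility: no task starts before time `0`, precedences are respected, and no processor
executes two tasks at the same time. -/
def Feasible (σ : Schedule P T) : Prop :=
  (∀ k, 0 ≤ σ.start k) ∧
  (∀ k' k, I.Prec k' k → I.completion σ k' ≤ σ.start k) ∧
  (∀ k' k, k' ≠ k → σ.proc k' = σ.proc k →
    I.completion σ k' ≤ σ.start k ∨ I.completion σ k ≤ σ.start k')

/-- The completion time of a job: that of its last finishing task. -/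
def jobCompletion (σ : Schedule P T) (j : J) : ℝ :=
  ⨆ k : {k : T // I.job k = j}, I.completion σ k

/-- The total weighted completion time of the jobs. -/
def cost [Fintype J] (σ : Schedule P T) : ℝ := ∑ j, I.w j * I.jobCompletion σ j

/-! ### The interval-indexed linear program -/

/-- The time horizon `∑ₖ maxᵢ p i k`. -/
def tmax [Fintype T] : ℝ := ∑ k, ⨆ i, I.p i k

/-- The smallest integer `L` with `(1 + δ) ^ (L - 1) ≥ tmax` (as `tmax ≥ 1`, it is positive). -/
def numIntervals [Fintype T] (δ : ℝ) : ℕ :=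
  sInf {L : ℕ | 1 ≤ L ∧ I.tmax ≤ (1 + δ) ^ (L - 1)}

/-- The index set `{1, …, L}` of the intervals `((1 + δ) ^ (ℓ - 1), (1 + δ) ^ ℓ]`. -/
def intervals [Fintype T] (δ : ℝ) : Finset ℕ := Icc 1 (I.numIntervals δ)

/-- `∑_{t ≤ ℓ} y i k t`, the sum being over the interval indices `t` in `{1, …, L}`. -/
def massUpTo [Fintype T] (δ : ℝ) (s : LPSolution P J T) (ℓ : ℕ) (i : P) (k : T) : ℝ :=
  ∑ t ∈ I.intervals δ with t ≤ ℓ, s.y i k t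

/-- The constraints of the linear program. -/
structure LPFeasible [Fintype P] [Fintype T] (δ : ℝ) (s : LPSolution P J T) : Prop where
  assigned : ∀ k, 1 ≤ ∑ i, ∑ ℓ ∈ I.intervals δ, s.y i k ℓ
  job_ge_task : ∀ k, s.Ctask k ≤ s.Cjob (I.job k)
  precedence : ∀ k' k, I.Prec k' k →
    s.Ctask k' + ∑ i, I.p i k * ∑ ℓ ∈ I.intervals δ, s.y i k ℓ ≤ s.Ctask k
  interval_le : ∀ k, ∑ i, ∑ ℓ ∈ I.intervals δ, (1 + δ) ^ (ℓ - 1) * s.y i k ℓ ≤ s.Ctask k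
  load : ∀ i, ∀ ℓ ∈ I.intervals δ, ∑ k, I.p i k * I.massUpTo δ s ℓ i k ≤ (1 + δ) ^ ℓ
  too_long : ∀ i k, ∀ ℓ ∈ I.intervals δ, (1 + δ) ^ ℓ < I.p i k → s.y i k ℓ = 0
  y_nonneg : ∀ i k, ∀ ℓ ∈ I.intervals δ, 0 ≤ s.y i k ℓ

/-- The objective function of the linear program. -/
def lpValue [Fintype J] (s : LPSolution P J T) : ℝ := ∑ j, I.w j * s.Cjob j

/-- Optimal solutions of the linear program. -/
def LPOptimal [Fintype P] [Fintype J] [Fintype T] (δ : ℝ) (s : LPSolution P J T) : Prop :=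
  I.LPFeasible δ s ∧ ∀ s', I.LPFeasible δ s' → I.lpValue s ≤ I.lpValue s'

end Instance

/-! ### Decomposition of a set of tasks into levels -/

/-- The elements of `S` without a predecessor in `S`. -/
def sources {T : Type*} (r : T → T → Prop) (S : Set T) : Set T :=
  {k | k ∈ S ∧ ∀ k' ∈ S, ¬ r k' k}

/-- What is left of `S` after its sources have been removed `n` times. -/
def remaining {T : Type*} (r : T → T → Prop) (S : Set T) : ℕ → Set T
  | 0 => S
  | n + 1 => remaining r S n \ sources r (remaining r S n)

/-- The level of index `n` (counted from `0`): the sources removed in step `n + 1`. -/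
def decompose {T : Type*} (r : T → T → Prop) (S : Set T) (n : ℕ) : Set T :=
  sources r (remaining r S n)

/-! ### Shmoys–Tardos rounding -/

/-- `f` is a possible result of the rounding of Shmoys and Tardos on the tasks of `V` with
fractional assignment `x`.  On every processor `i` the tasks are sorted by non-increasing
processing times (`rank i`, ties broken arbitrarily) and their fractions `x i k` are laid out in
this order consecutively on the half-line, which is cut into the unit slots `[n, n + 1]`.  Task `k`
is joined to the slot `n` of processor `i` if a positive part of its fraction lies in that slot.  A
matching of this bipartite graph that covers all tasks (`k` is matched to slot `slot k` of
processor `f k`) gives the integral assignment. -/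
def IsShmoysTardosRounding {P T : Type*} [Fintype T] (p x : P → T → ℝ) (V : Set T)
    (f : T → P) : Prop :=
  ∃ rank : P → T → ℕ,
    (∀ i, Set.InjOn (rank i) V) ∧
    (∀ i, ∀ k ∈ V, ∀ k' ∈ V, rank i k < rank i k' → p i k' ≤ p i k) ∧
    ∃ slot : T → ℕ,
      Set.InjOn (fun k => (f k, slot k)) V ∧
      ∀ k ∈ V,
        let before : ℝ := ∑ k' with k' ∈ V ∧ rank (f k) k' < rank (f k) k, x (f k) k'
        max before (slot k : ℝ) < min (before + x (f k) k) ((slot k : ℝ) + 1)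

/-! ### The algorithm -/

/-- The bucket `S(ℓ)` of the tasks with `(1 + δ) ^ (ℓ - 1) ≤ α C̄ₖ < (1 + δ) ^ ℓ`, `ℓ ≥ 1`. -/
def bucket {P J T : Type*} (α δ : ℝ) (s : LPSolution P J T) (ℓ : ℕ) : Set T :=
  {k | 1 ≤ ℓ ∧ (1 + δ) ^ (ℓ - 1) ≤ α * s.Ctask k ∧ α * s.Ctask k < (1 + δ) ^ ℓ}

namespace Instance

variable {P J T : Type*} (I : Instance P J T)

/-- The level of index `n` (counted from `0`) of the bucket `S(ℓ)`. -/
def level (α δ : ℝ) (s : LPSolution P J T) (ℓ n : ℕ) : Set T :=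
  decompose I.Prec (bucket α δ s ℓ) n

/-- The fractional assignment of the tasks of `S(ℓ)` given by the linear program: the part of
`y` in the intervals up to `ℓ`, normalised to total mass `1`. -/
def fracAssign [Fintype P] [Fintype T] (δ : ℝ) (s : LPSolution P J T) (ℓ : ℕ) (i : P) (k : T) :
    ℝ :=
  I.massUpTo δ s ℓ i k / ∑ i', I.massUpTo δ s ℓ i' k

/-- `σ` is a possible output of the algorithm Multi-round MRS with parameters `α`, `δ` on the
fractional solution `s`.  The tasks are placed one after the other, in the order of `ord`, which is
increasing in the bucket `ℓ` and, within a bucket, in the level `n`; the order within a level is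
arbitrary.  Every level is assigned to the processors by Shmoys–Tardos rounding, and every task
starts as early as possible on its processor, given its precedences and the tasks already placed. -/
def IsOutput [Fintype P] [Fintype T] (α δ : ℝ) (s : LPSolution P J T) (σ : Schedule P T) : Prop :=
  (∀ ℓ n, IsShmoysTardosRounding I.p (I.fracAssign δ s ℓ) (I.level α δ s ℓ n) σ.proc) ∧
  ∃ ord : T → ℕ, Function.Injective ord ∧
    (∀ ℓ n ℓ' n', ∀ k ∈ I.level α δ s ℓ n, ∀ k' ∈ I.level α δ s ℓ' n',
      (ℓ < ℓ' ∨ ℓ = ℓ' ∧ n < n') → ord k < ord k') ∧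
    ∀ k, IsLeast
      {τ : ℝ | 0 ≤ τ ∧ (∀ k', I.Prec k' k → I.completion σ k' ≤ τ) ∧
        ∀ k', ord k' < ord k → σ.proc k' = σ.proc k →
          I.completion σ k' ≤ τ ∨ τ + I.p (σ.proc k) k ≤ σ.start k'}
      (σ.start k)

end Instance

/-- The approximation ratio
`α [(l+1) α/(α-1) + l α/(δ(α-1)) + l + 1 + (l+1)/δ] (1 + δ)`. -/
def ratio (α δ l : ℝ) : ℝ :=
  α * ((l + 1) * (α / (α - 1)) + l * (α / (δ * (α - 1))) + l + 1 + (l + 1) / δ) * (1 + δ)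

end

end MapReduce

namespace MapReduce

/-! ### Shmoys–Tardos rounding -/

/-! The LP is a relaxation: deleting the globally idle times of a schedule puts every completion
time below `tmax`, and the indicators of the intervals containing those times are LP-feasible
(`Feasible.exists_lpFeasible`). So it suffices to bound each completion time in the output by
`ratio` times the LP value of the task.

Two estimates bound the load of a processor. Markov's inequality shows that a task of bucket `ℓ` has
LP mass at least `1 - 1/α` in the intervals up to `ℓ`, so normalising costs a factor `A = α/(α-1)`,
and the fractional load of all buckets up to `ℓ` together is at most `A(1+δ)^ℓ`. Shmoys–Tardos
rounding then adds at most one longest task, of length at most `(1+δ)^ℓ`, for each level.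

Trace back the tasks that delay `k` on its processor until one is reached that starts at time 0 or
at the completion of a predecessor `k₁` (`exists_completion_le`). Everything executed in between
lies in levels after that of `k₁`. Iterating, the rounding terms run over disjoint ranges of levels
and are paid once, while each link of the chain pays `A(1+δ)^ℓ` for its bucket
(`IsOutput.completion_le`). The precedence graph is graded with heights `0, …, lmax`, so a bucket
has at most `lmax + 1` levels; every bucket except the last is charged at most `lmax` times, because
the task where the chain leaves it still has a successor. Geometric sums give `ratio`.

Existence needs Hall's theorem for the rounding, compactness for the LP optimum, and attained infima
for the greedy starting times. -/

theorem mul_sum_le_sum_mul_of_partial_sums_nonneg {T : Type*} (rank : T → ℕ) (p d : T → ℝ)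
    (s : Finset T) (hinj : Set.InjOn rank s)
    (hp : ∀ k ∈ s, ∀ k' ∈ s, rank k < rank k' → p k' ≤ p k)
    (hd : ∀ k ∈ s, 0 ≤ ∑ k' ∈ s with rank k' ≤ rank k, d k')
    (c : ℝ) (hc0 : 0 ≤ c) (hc : ∀ k ∈ s, c ≤ p k) :
    c * ∑ k ∈ s, d k ≤ ∑ k ∈ s, p k * d k := by
  induction s using Finset.induction_on_max_value rank generalizing c with
  | empty => simp
  | insert a s ha hmax ih =>
    have hlt : ∀ k ∈ s, rank k < rank a := fun k hk =>
      lt_of_le_of_ne (hmax k hk) fun h => ha (by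
        rwa [← hinj (by simp [hk]) (by simp) h])
    -- Abel summation: the last task has the smallest `p`, so the earlier ones are bounded with `p
    -- a` in place of `c`; then `p a` is lowered to `c` on the full sum, which is nonnegative.
    have h1 := ih (hinj.mono (by simp)) (fun k hk k' hk' => hp k (by simp [hk]) k' (by simp [hk']))
      (fun k hk => by
        have := hd k (by simp [hk])
        rwa [filter_insert, if_neg (not_le.2 (hlt k hk))] at this)
      (p a) (hc0.trans (hc a (by simp))) (fun k hk => hp k (by simp [hk]) a (by simp) (hlt k hk))
    have h2 := hd a (by simp)
    rw [filter_true_of_mem (by simpa using hmax)] at h2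
    have h3 := mul_le_mul_of_nonneg_right (hc a (by simp)) h2
    rw [sum_insert ha] at h2 h3 ⊢
    rw [sum_insert ha]
    linarith [mul_add (p a) (d a) (∑ k ∈ s, d k)]

/-- Slot 0 receives at most one task, which costs `q`. The tasks in later slots are charged to
fractional mass laid out no later than themselves, hence belonging to tasks at least as long. -/
theorem IsShmoysTardosRounding.load_le {P T : Type*} [Fintype T] {p x : P → T → ℝ} {V : Set T}
    {f : T → P} (h : IsShmoysTardosRounding p x V f) (i : P) (hx : ∀ k ∈ V, 0 ≤ x i k)
    (hp : ∀ k ∈ V, 0 ≤ p i k) (q : ℝ) (hq0 : 0 ≤ q) (hq : ∀ k ∈ V, 0 < x i k → p i k ≤ q) :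
    ∑ k with k ∈ V ∧ f k = i, p i k ≤ ∑ k with k ∈ V, p i k * x i k + q := by
  obtain ⟨rank, hrank, hsort, slot, hslot, hjoin⟩ := h
  have hjoin' : ∀ k ∈ V, f k = i → 0 < x i k ∧
      (slot k : ℝ) ≤ ∑ k' with k' ∈ V ∧ rank i k' ≤ rank i k, x i k' := by
    rintro k hk rfl
    have := hjoin k hk
    simp only [max_lt_iff, lt_min_iff] at this
    refine ⟨by linarith [this.1.1], this.1.2.le.trans (le_of_eq ?_)⟩
    have : (univ.filter fun k' => k' ∈ V ∧ rank (f k) k' ≤ rank (f k) k) =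
        insert k (univ.filter fun k' => k' ∈ V ∧ rank (f k) k' < rank (f k) k) := by
      ext k'
      simp only [mem_filter, mem_univ, true_and, mem_insert]
      constructor
      · rintro ⟨h1, h2⟩
        rcases h2.lt_or_eq with h2 | h2
        · exact Or.inr ⟨h1, h2⟩
        · exact Or.inl (hrank _ h1 hk h2)
      · rintro (rfl | h)
        · exact ⟨hk, le_rfl⟩
        · exact ⟨h.1, h.2.le⟩
    rw [this, sum_insert (by simp), add_comm]
  -- `d` is fractional mass minus the number of tasks placed in slots from 1 on. Its partial sums
  -- are nonnegative: such tasks up to rank `k` occupy distinct slots in `1, …, slot m`, and the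
  -- fraction of `m` reaches into slot `slot m`, so the mass up to `m` is at least `slot m`.
  have key := mul_sum_le_sum_mul_of_partial_sums_nonneg (rank i) (p i)
    (fun k => x i k - if f k = i ∧ 1 ≤ slot k then 1 else 0) (univ.filter (· ∈ V))
    (by simpa using hrank i) (by simpa using hsort i)
    (by
      intro k hk
      rw [filter_filter, sum_sub_distrib, sub_nonneg, ← sum_filter, filter_filter, sum_const,
        nsmul_eq_mul, mul_one]
      set D := univ.filter fun k' => (k' ∈ V ∧ rank i k' ≤ rank i k) ∧ f k' = i ∧ 1 ≤ slot k'
        with hD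
      rcases D.eq_empty_or_nonempty with h0 | hne
      · rw [h0]
        simp only [card_empty, Nat.cast_zero]
        exact sum_nonneg fun k' hk' => hx k' (by simp at hk'; exact hk'.1)
      obtain ⟨m, hm, hmax⟩ := exists_max_image D slot hne
      have hcard : D.card ≤ slot m := by
        rw [← Nat.add_sub_cancel (slot m) 1, ← Nat.card_Icc 1 (slot m)]
        refine card_le_card_of_injOn slot (fun k' hk' => ?_) (fun a ha b hb hab => ?_)
        · have := hmax k' hk'
          simp [hD] at hk'
          simp; omega
        · simp [hD] at ha hb
          exact hslot ha.1.1 hb.1.1 (by simp [ha.2.1, hb.2.1, hab])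
      simp [hD] at hm
      refine (Nat.cast_le.2 hcard).trans ((hjoin' m hm.1.1 hm.2.1).2.trans ?_)
      refine sum_le_sum_of_subset_of_nonneg (fun k' hk' => ?_) fun k' hk' _ => hx k' ?_
      · simp at hk' ⊢
        exact ⟨hk'.1, hk'.2.trans hm.1.2⟩
      · simp at hk'
        exact hk'.1)
    0 le_rfl (by simpa using hp)
  have h0 : ∑ k with (k ∈ V ∧ f k = i) ∧ slot k = 0, p i k ≤ q := by
    have hc : (univ.filter fun k => (k ∈ V ∧ f k = i) ∧ slot k = 0).card ≤ 1 := by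
      rw [card_le_one]
      intro a ha b hb
      simp at ha hb
      exact hslot ha.1.1 hb.1.1 (by simp [ha.1.2, hb.1.2, ha.2, hb.2])
    refine (sum_le_card_nsmul _ _ q fun k hk => ?_).trans ?_
    · simp at hk
      exact hq k hk.1.1 (hjoin' k hk.1.1 hk.1.2).1
    · rw [nsmul_eq_mul]
      exact mul_le_of_le_one_left hq0 (by exact_mod_cast hc)
  have hsplit := sum_filter_add_sum_filter_not (univ.filter fun k => k ∈ V ∧ f k = i)
    (fun k => slot k = 0) (p i)
  rw [filter_filter, filter_filter] at hsplit
  simp only [mul_sub, sum_sub_distrib, zero_mul, mul_ite, mul_one, mul_zero, ← sum_filter,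
    filter_filter] at key
  have heq : (univ.filter fun k => k ∈ V ∧ f k = i ∧ 1 ≤ slot k) =
      univ.filter fun k => (k ∈ V ∧ f k = i) ∧ ¬ slot k = 0 := by
    ext k; simp [and_assoc, Nat.one_le_iff_ne_zero]
  rw [heq] at key
  linarith

/-! ### Existence of a rounding: Hall's theorem -/

theorem exists_antitone_rank {T : Type*} [Fintype T] (g : T → ℝ) :
    ∃ rank : T → ℕ, Function.Injective rank ∧ ∀ k k', rank k < rank k' → g k' ≤ g k := by
  let e := Fintype.equivFin T
  let f : Fin (Fintype.card T) → ℝ := fun a => - g (e.symm a)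
  refine ⟨fun k => ((Tuple.sort f).symm (e k) : Fin _), fun a b h => ?_, fun k k' h => ?_⟩
  · exact e.injective ((Tuple.sort f).symm.injective (Fin.ext h))
  · have := Tuple.monotone_sort f (Fin.le_of_lt h)
    simpa [f] using this

theorem sum_telescope_rank {T : Type*} (rank : T → ℕ) (x : T → ℝ) (F : ℝ → ℝ) (s : Finset T)
    (hinj : Set.InjOn rank s) :
    ∑ k ∈ s, (F (∑ k' ∈ s with rank k' < rank k, x k' + x k) -
      F (∑ k' ∈ s with rank k' < rank k, x k')) = F (∑ k ∈ s, x k) - F 0 := by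
  induction s using Finset.induction_on_max_value rank with
  | empty => simp
  | insert a s ha hmax ih =>
    have hlt : ∀ k ∈ s, rank k < rank a := fun k hk =>
      lt_of_le_of_ne (hmax k hk) fun h => ha (by
        rwa [← hinj (by simp [hk]) (by simp) h])
    have h1 : ∀ k ∈ s, (insert a s).filter (fun k' => rank k' < rank k) =
        s.filter (fun k' => rank k' < rank k) := fun k hk => by
      rw [filter_insert, if_neg (hlt k hk).not_gt]
    have h2 : (insert a s).filter (fun k' => rank k' < rank a) = s := by
      rw [filter_insert, if_neg (lt_irrefl _), filter_true_of_mem hlt]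
    have h3 := ih (hinj.mono (by simp))
    rw [sum_congr rfl fun k hk => by rw [← h1 k hk]] at h3
    rw [sum_insert ha, h2, h3, sum_insert ha, add_comm (x a)]
    ring

/-- The summand is the length of `[0, u] ∩ [n, n+1]`. -/
theorem sum_range_clamp (u : ℝ) (hu : 0 ≤ u) (N : ℕ) :
    ∑ n ∈ range N, min (max (u - n) 0) 1 = min u N := by
  induction N with
  | zero => simp [hu]
  | succ N ih =>
    rw [sum_range_succ, ih]
    push_cast
    rcases le_total u N with h | h
    · rw [min_eq_left h, max_eq_right (by linarith), min_eq_left (by linarith),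
        min_eq_left (by linarith), add_zero]
    · rw [min_eq_right h, max_eq_left (by linarith)]
      rcases le_total u (N + 1) with h' | h'
      · rw [min_eq_left h', min_eq_left (by linarith)]; ring
      · rw [min_eq_right h', min_eq_right (by linarith)]

theorem exists_isShmoysTardosRounding {P T : Type*} [Fintype P] [Nonempty P] [Fintype T]
    (p x : P → T → ℝ) (V : Set T) (hx0 : ∀ i, ∀ k ∈ V, 0 ≤ x i k)
    (hx1 : ∀ k ∈ V, ∑ i, x i k = 1) : ∃ f, IsShmoysTardosRounding p x V f := by
  choose rank hinj hsort using fun i => exists_antitone_rank (p i)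
  let b : P → T → ℝ := fun i k => ∑ k' with k' ∈ V ∧ rank i k' < rank i k, x i k'
  obtain ⟨N, hN⟩ : ∃ N : ℕ, ∀ i, ∑ k with k ∈ V, x i k ≤ N := by
    obtain ⟨M, hM⟩ := (Set.finite_range fun i => ∑ k with k ∈ V, x i k).bddAbove
    obtain ⟨N, hN⟩ := exists_nat_ge M
    exact ⟨N, fun i => (hM ⟨i, rfl⟩).trans hN⟩
  have hb0 : ∀ i k, 0 ≤ b i k := fun i k => sum_nonneg fun k' hk' => hx0 i k' (by
    simp at hk'; exact hk'.1)
  have hbN : ∀ i, ∀ k ∈ V, b i k + x i k ≤ N := by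
    intro i k hk
    refine le_trans ?_ (hN i)
    have : b i k + x i k =
        ∑ k' ∈ insert k (univ.filter fun k' => k' ∈ V ∧ rank i k' < rank i k), x i k' := by
      rw [sum_insert (by simp), add_comm]
    rw [this]
    refine sum_le_sum_of_subset_of_nonneg (fun k' hk' => ?_) fun k' hk' _ => hx0 i k' ?_
    · simp at hk' ⊢
      rcases hk' with rfl | h
      exacts [hk, h.1]
    · simpa using hk'
  let clamp : ℕ → ℝ → ℝ := fun n u => min (max (u - n) 0) 1
  have hclamp : ∀ n, Monotone (clamp n) := fun n u v huv =>
    min_le_min_right _ (max_le_max_right _ (by linarith))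
  -- Length of the part of the fraction of `k` on processor `z.1` lying in slot `z.2`. Tasks have
  -- total weight 1 and slots at most 1, so double counting yields Hall's condition.
  let wt : P × ℕ → T → ℝ := fun z k => clamp z.2 (b z.1 k + x z.1 k) - clamp z.2 (b z.1 k)
  have hwt0 : ∀ z, ∀ k ∈ V, 0 ≤ wt z k := fun z k hk =>
    sub_nonneg.2 (hclamp _ (by linarith [hx0 z.1 k hk]))
  have hwtV : ∀ z, ∑ k with k ∈ V, wt z k ≤ 1 := by
    intro z
    have := sum_telescope_rank (rank z.1) (x z.1) (clamp z.2) (univ.filter (· ∈ V))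
      ((hinj z.1).injOn)
    simp only [filter_filter] at this
    refine this.le.trans ?_
    have h1 : clamp z.2 (∑ k with k ∈ V, x z.1 k) ≤ 1 := min_le_right _ _
    have h2 : 0 ≤ clamp z.2 0 := le_min (le_max_right _ _) zero_le_one
    linarith
  let R : Finset (P × ℕ) := univ ×ˢ range N
  have hwtk : ∀ k ∈ V, ∑ z ∈ R, wt z k = 1 := by
    intro k hk
    rw [sum_product, ← hx1 k hk]
    refine sum_congr rfl fun i _ => ?_
    simp only [wt, sum_sub_distrib, clamp]
    have h1 := hbN i k hk
    have h2 := hx0 i k hk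
    rw [sum_range_clamp _ (by linarith [hb0 i k]), sum_range_clamp _ (hb0 i k),
      min_eq_left h1, min_eq_left (by linarith)]
    ring
  let t : V → Finset (P × ℕ) := fun k => R.filter fun z => 0 < wt z k
  have hall : ∀ s : Finset V, s.card ≤ (s.biUnion t).card := by
    intro s
    have h1 : (s.card : ℝ) = ∑ k ∈ s, ∑ z ∈ s.biUnion t, wt z k := by
      rw [card_eq_sum_ones, Nat.cast_sum]
      refine sum_congr rfl fun k hk => ?_
      rw [Nat.cast_one, ← hwtk k k.2]
      symm
      refine sum_subset (fun z hz => ?_) fun z hz hz' => ?_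
      · obtain ⟨k', _, h⟩ := mem_biUnion.1 hz
        exact (mem_filter.1 h).1
      · refine le_antisymm (not_lt.1 fun h => hz' ?_) (hwt0 z k k.2)
        exact mem_biUnion.2 ⟨k, hk, mem_filter.2 ⟨hz, h⟩⟩
    have h2 : ∑ k ∈ s, ∑ z ∈ s.biUnion t, wt z k ≤ (s.biUnion t).card := by
      rw [sum_comm, card_eq_sum_ones, Nat.cast_sum]
      refine sum_le_sum fun z _ => ?_
      rw [Nat.cast_one]
      refine le_trans ?_ (hwtV z)
      refine (sum_map s (Function.Embedding.subtype (· ∈ V)) (wt z)).symm.le.trans ?_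
      refine sum_le_sum_of_subset_of_nonneg (fun k hk => ?_) fun k hk _ =>
        hwt0 z k (by simpa using hk)
      simp at hk ⊢
      exact hk.1
    exact_mod_cast h1.le.trans h2
  obtain ⟨g, hg, hgt⟩ := (Finset.all_card_le_biUnion_card_iff_exists_injective t).1 hall
  refine ⟨fun k => if h : k ∈ V then (g ⟨k, h⟩).1 else Classical.arbitrary P, rank,
    fun i => (hinj i).injOn, fun i k _ k' _ => hsort i k k',
    fun k => if h : k ∈ V then (g ⟨k, h⟩).2 else 0, ?_, ?_⟩
  · intro k hk k' hk' h
    simp only [dif_pos hk, dif_pos hk', Prod.mk.eta] at h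
    exact congrArg Subtype.val (hg h)
  · intro k hk
    have := (mem_filter.1 (hgt ⟨k, hk⟩)).2
    simp only [dif_pos hk]
    set z := g ⟨k, hk⟩
    have hlt : clamp z.2 (b z.1 k) < clamp z.2 (b z.1 k + x z.1 k) := sub_pos.1 this
    change max (b z.1 k) (z.2 : ℝ) < min (b z.1 k + x z.1 k) ((z.2 : ℝ) + 1)
    have hxpos : b z.1 k < b z.1 k + x z.1 k := (hclamp z.2).reflect_lt hlt
    simp only [clamp] at hlt
    rw [max_lt_iff, lt_min_iff, lt_min_iff]
    refine ⟨⟨hxpos, ?_⟩, ?_, by linarith⟩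
    · by_contra! h
      rw [min_eq_right (a := max (b z.1 k - z.2) 0) (le_max_of_le_left (by linarith))] at hlt
      exact absurd (min_le_right _ _) (not_le.2 hlt)
    · by_contra! h
      rw [max_eq_right (a := b z.1 k + x z.1 k - z.2) (by linarith)] at hlt
      refine absurd hlt (not_lt.2 (min_le_min_right _ (le_max_right _ _)))

/-! ### Levels of the precedence graph -/

namespace Instance

variable {P J T : Type*} (I : Instance P J T)

/-- The number of edges of a longest path of the precedence graph that ends at task `k`. -/
def height (k : T) : ℕ := 2 * (I.round k - 1) + if I.isReduce k then 1 else 0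

variable {I} in
-- The precedence graph is graded: map tasks of round `q` have height `2(q-1)` and reduce tasks
-- `2q-1`.
theorem Prec.height_eq {k' k : T} (h : I.Prec k' k) : I.height k = I.height k' + 1 := by
  have h1 := I.one_le_round k
  have h2 := I.one_le_round k'
  obtain ⟨_, ⟨a, b, c⟩ | ⟨a, b, c⟩⟩ := h
  · simp [height, a, b, c]
  · simp only [height, a, b, c]; simp; omega

theorem height_lt (k : T) : I.height k < 2 * I.rounds (I.job k) := by
  have h1 := I.one_le_round k
  have h2 := I.round_le k
  unfold height
  split_ifs <;> omega

theorem height_lt_two_mul_rmax [Fintype J] (k : T) : I.height k < 2 * I.rmax :=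
  (I.height_lt k).trans_le (Nat.mul_le_mul_left 2 (le_sup (f := I.rounds) (mem_univ _)))

theorem one_le_rmax [Fintype J] [Nonempty J] : 1 ≤ I.rmax :=
  (I.one_le_rounds (Classical.arbitrary J)).trans (le_sup (f := I.rounds) (mem_univ _))

variable {I} in
theorem height_getLast_of_isChain {k : T} {path : List T} (h : (k :: path).IsChain I.Prec) :
    path.length ≤ I.height ((k :: path).getLast (by simp)) := by
  suffices H : path.length + I.height k = I.height ((k :: path).getLast (by simp)) by omega
  induction path generalizing k with
  | nil => simp
  | cons a path ih =>
    rw [List.isChain_cons_cons] at h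
    have := ih h.2
    rw [h.1.height_eq] at this
    rw [List.getLast_cons (by simp), ← this, List.length_cons]
    omega

theorem exists_path (j : J) : ∃ path : List T, path.IsChain I.Prec ∧
    path.length = 2 * I.rounds j := by
  -- The path alternates map and reduce tasks. The bound sits inside the existential so that the
  -- choice is a total function on `ℕ`.
  have h : ∀ m, ∃ k, m < 2 * I.rounds j →
      I.job k = j ∧ I.round k = m / 2 + 1 ∧ I.isReduce k = decide (m % 2 = 1) := by
    intro m
    obtain ⟨k₀, -⟩ := I.exists_task j 1 true le_rfl (I.one_le_rounds j)
    by_cases hm : m < 2 * I.rounds j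
    · obtain ⟨k, hk⟩ := I.exists_task j (m / 2 + 1) (decide (m % 2 = 1)) (by omega) (by omega)
      exact ⟨k, fun _ => hk⟩
    · exact ⟨k₀, fun h => absurd h hm⟩
  choose t ht using h
  refine ⟨(List.range (2 * I.rounds j)).map t, ?_, by simp⟩
  rw [List.isChain_map, List.isChain_range]
  intro m hm
  obtain ⟨a1, a2, a3⟩ := ht m (by omega)
  obtain ⟨b1, b2, b3⟩ := ht (m + 1) (by omega)
  refine ⟨a1.trans b1.symm, ?_⟩
  rw [a2, a3, b2, b3]
  rcases Nat.mod_two_eq_zero_or_one m with h | h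
  · left; simp; omega
  · right; simp; omega

theorem lmax_add_one [Fintype J] [Nonempty J] : I.lmax + 1 = 2 * I.rmax := by
  have hr := I.one_le_rmax
  -- This also supplies boundedness: in `ℕ` the supremum of an unbounded set is 0.
  have hub : ∀ n ∈ {n | ∃ path : List T, path.IsChain I.Prec ∧ path.length = n + 1},
      n ≤ 2 * I.rmax - 1 := by
    rintro n ⟨path, hpath, hlen⟩
    match path, hpath, hlen with
    | k :: path, hpath, hlen =>
      have h1 := height_getLast_of_isChain hpath
      have h2 := I.height_lt_two_mul_rmax ((k :: path).getLast (by simp))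
      simp at hlen
      omega
  obtain ⟨j, -, hj⟩ := exists_mem_eq_sup univ univ_nonempty I.rounds
  have hmem : 2 * I.rmax - 1 ∈
      {n | ∃ path : List T, path.IsChain I.Prec ∧ path.length = n + 1} := by
    obtain ⟨path, hpath, hlen⟩ := I.exists_path j
    refine ⟨path, hpath, ?_⟩
    rw [hlen, ← hj]
    change 2 * I.rmax = _
    omega
  have h1 : I.lmax ≤ 2 * I.rmax - 1 := csSup_le ⟨_, hmem⟩ hub
  have h2 : 2 * I.rmax - 1 ≤ I.lmax := le_csSup ⟨_, hub⟩ hmem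
  omega

theorem height_le_lmax [Fintype J] [Nonempty J] (k : T) : I.height k ≤ I.lmax := by
  have h1 := I.lmax_add_one
  have h2 := I.height_lt_two_mul_rmax k
  omega

end Instance

theorem remaining_antitone {T : Type*} (r : T → T → Prop) (S : Set T) :
    Antitone (remaining r S) :=
  antitone_nat_of_succ_le fun _ => Set.sdiff_subset

namespace Instance

variable {P J T : Type*} (I : Instance P J T)

/-- A task that survives one more removal has a predecessor that survived all the previous ones, and
that predecessor is one lower. -/
theorem le_height_of_mem_remaining (S : Set T) (n : ℕ) (k : T)
    (hk : k ∈ remaining I.Prec S n) : n ≤ I.height k := by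
  induction n generalizing k with
  | zero => simp
  | succ n ih =>
    obtain ⟨h1, h2⟩ := hk
    simp only [sources, Set.mem_ofPred_eq, not_and, not_forall, not_not] at h2
    obtain ⟨k', hk', h⟩ := h2 h1
    rw [h.height_eq]
    exact Nat.succ_le_succ (ih k' hk')

theorem exists_mem_decompose {S : Set T} {k : T} (hk : k ∈ S) :
    ∃ n, k ∈ decompose I.Prec S n := by
  by_contra! h
  have : ∀ n, k ∈ remaining I.Prec S n := by
    intro n
    induction n with
    | zero => exact hk
    | succ n ih => exact ⟨ih, h n⟩
  have := I.le_height_of_mem_remaining S _ k (this (I.height k + 1))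
  omega

end Instance

theorem decompose_index_lt {T : Type*} {r : T → T → Prop} {S : Set T} {k' k : T} {n' n : ℕ}
    (hk' : k' ∈ decompose r S n') (hk : k ∈ decompose r S n) (h : r k' k) : n' < n := by
  by_contra! hn
  exact hk.2 k' (remaining_antitone r S hn hk'.1) h

theorem decompose_index_unique {T : Type*} {r : T → T → Prop} {S : Set T} {k : T} {n' n : ℕ}
    (h' : k ∈ decompose r S n') (h : k ∈ decompose r S n) : n' = n := by
  have H : ∀ {a b}, k ∈ decompose r S a → k ∈ decompose r S b → ¬ a < b := fun ha hb hlt =>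
    (remaining_antitone r S hlt hb.1).2 ha
  exact le_antisymm (not_lt.1 (H h h')) (not_lt.1 (H h' h))

/-! ### Buckets: every task lies in exactly one level -/

theorem bucket_index_mono {P J T : Type*} {α δ : ℝ} (hα : 0 < α) (hδ : 0 < δ)
    {s : LPSolution P J T} {k' k : T} {ℓ' ℓ : ℕ} (hk' : k' ∈ bucket α δ s ℓ')
    (hk : k ∈ bucket α δ s ℓ) (h : s.Ctask k' ≤ s.Ctask k) : ℓ' ≤ ℓ := by
  have h1 : (1 + δ) ^ (ℓ' - 1) < (1 + δ) ^ ℓ :=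
    hk'.2.1.trans_lt ((mul_le_mul_of_nonneg_left h hα.le).trans_lt hk.2.2)
  have := (pow_lt_pow_iff_right₀ (by linarith)).1 h1
  have := hk'.1
  omega

theorem exists_mem_bucket {P J T : Type*} {α δ : ℝ} (hα : 1 ≤ α) (hδ : 0 < δ)
    {s : LPSolution P J T} {k : T} (h : 1 ≤ s.Ctask k) : ∃ ℓ, k ∈ bucket α δ s ℓ := by
  obtain ⟨n, h1, h2⟩ := exists_nat_pow_near (one_le_mul_of_one_le_of_one_le hα h)
    (show 1 < 1 + δ by linarith)
  exact ⟨n + 1, by simp, by simpa using h1, h2⟩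

namespace Instance

variable {P J T : Type*} (I : Instance P J T)

theorem exists_level_indices {α δ : ℝ} (hα : 1 ≤ α) (hδ : 0 < δ) {s : LPSolution P J T}
    (hs : ∀ k, 1 ≤ s.Ctask k) :
    ∃ b n : T → ℕ, ∀ k ℓ m, k ∈ I.level α δ s ℓ m ↔ b k = ℓ ∧ n k = m := by
  choose b hb using fun k => exists_mem_bucket hα hδ (hs k)
  choose n hn using fun k => I.exists_mem_decompose (hb k)
  refine ⟨b, n, fun k ℓ m => ⟨fun h => ?_, ?_⟩⟩
  · have hℓ : k ∈ bucket α δ s ℓ := remaining_antitone _ _ (Nat.zero_le m) h.1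
    have : b k = ℓ := le_antisymm (bucket_index_mono (by linarith) hδ (hb k) hℓ le_rfl)
      (bucket_index_mono (by linarith) hδ hℓ (hb k) le_rfl)
    subst this
    exact ⟨rfl, decompose_index_unique (hn k) h⟩
  · rintro ⟨rfl, rfl⟩
    exact hn k

theorem mem_bucket_of_mem_level {α δ : ℝ} {s : LPSolution P J T} {ℓ n : ℕ} {k : T}
    (h : k ∈ I.level α δ s ℓ n) : k ∈ bucket α δ s ℓ :=
  remaining_antitone _ _ (Nat.zero_le n) h.1

end Instance

/-! ### Schedules -/

/-- A family of indices refined to an injective one. -/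
theorem exists_injective_refinement {T : Type*} [Fintype T] (g : T → ℕ) :
    ∃ ord : T → ℕ, Function.Injective ord ∧ ∀ k' k, g k' < g k → ord k' < ord k := by
  let e := Fintype.equivFin T
  have hlt : ∀ k' k, g k' < g k → g k' * Fintype.card T + e k' < g k * Fintype.card T + e k := by
    intro k' k h
    calc g k' * Fintype.card T + e k' < (g k' + 1) * Fintype.card T := by
          rw [add_one_mul]; exact Nat.add_lt_add_left (e k').2 _
      _ ≤ g k * Fintype.card T := Nat.mul_le_mul_right _ h
      _ ≤ _ := Nat.le_add_right _ _
  refine ⟨fun k => g k * Fintype.card T + e k, fun a b hab => ?_, hlt⟩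
  rcases lt_trichotomy (g a) (g b) with h | h | h
  · exact absurd hab (hlt a b h).ne
  · simp only [h] at hab
    exact e.injective (Fin.ext (Nat.add_left_cancel hab))
  · exact absurd hab (hlt b a h).ne'

namespace Instance

variable {P J T : Type*} (I : Instance P J T)

theorem p_pos (i : P) (k : T) : 0 < I.p i k := zero_lt_one.trans_le (I.one_le_p i k)

variable {I} in
theorem Feasible.one_le_completion {σ : Schedule P T} (h : I.Feasible σ) (k : T) :
    1 ≤ I.completion σ k := by
  have h1 := h.1 k
  have h2 := I.one_le_p (σ.proc k) k
  unfold completion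
  linarith

theorem p_le_tmax_summand [Finite P] (i : P) (k : T) : I.p i k ≤ ⨆ i, I.p i k :=
  le_ciSup (f := fun i => I.p i k) (Set.finite_range _).bddAbove i

variable {I} in
open MeasureTheory in
/-- Removing the times at which all processors are idle. -/
theorem Feasible.exists_completion_le_tmax [Finite P] [Fintype T] {σ : Schedule P T}
    (h : I.Feasible σ) : ∃ σ' : Schedule P T, I.Feasible σ' ∧
      (∀ k, I.completion σ' k ≤ I.completion σ k) ∧ ∀ k, I.completion σ' k ≤ I.tmax := by
  let U : Set ℝ := ⋃ k, Set.Ico (σ.start k) (I.completion σ k)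
  have hU : MeasurableSet U := MeasurableSet.iUnion fun k => measurableSet_Ico
  -- `f t` is the time before `t` at which some processor is busy. It is monotone, hence preserves
  -- the order constraints, and grows by exactly the processing time while a task runs.
  let f : ℝ → ℝ := fun t => volume.real (U ∩ Set.Ico 0 t)
  have hfin : ∀ t, volume (U ∩ Set.Ico 0 t) ≠ ⊤ := fun t =>
    ((measure_mono Set.inter_subset_right).trans_lt measure_Ico_lt_top).ne
  have hmono : Monotone f := fun a b hab =>
    measureReal_mono (Set.inter_subset_inter_right _ (Set.Ico_subset_Ico_right hab)) (hfin b)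
  have hle : ∀ t, 0 ≤ t → f t ≤ t := fun t ht => by
    refine (measureReal_mono Set.inter_subset_right measure_Ico_lt_top.ne).trans ?_
    rw [Real.volume_real_Ico_of_le ht, sub_zero]
  have htot : ∀ t, f t ≤ I.tmax := fun t => by
    have h1 : f t ≤ volume.real (⋃ k ∈ (univ : Finset T),
        Set.Ico (σ.start k) (I.completion σ k)) := by
      refine measureReal_mono (Set.inter_subset_left.trans (by simp [U])) ?_
      exact ((measure_biUnion_finset_le _ _).trans_lt
        (ENNReal.sum_lt_top.2 fun k _ => measure_Ico_lt_top)).ne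
    refine (h1.trans (measureReal_biUnion_finset_le _ _)).trans (sum_le_sum fun k _ => ?_)
    have h2 := I.p_le_tmax_summand (σ.proc k) k
    have h3 := I.p_pos (σ.proc k) k
    rw [Real.volume_real_Ico_of_le (by unfold completion; linarith)]
    unfold completion
    linarith
  have hrun : ∀ k, f (I.completion σ k) = f (σ.start k) + I.p (σ.proc k) k := fun k => by
    have h3 := I.p_pos (σ.proc k) k
    have h4 := h.1 k
    have hlt : σ.start k < I.completion σ k := by unfold completion; linarith
    have h5 : U ∩ Set.Ico 0 (I.completion σ k) =
        (U ∩ Set.Ico 0 (σ.start k)) ∪ Set.Ico (σ.start k) (I.completion σ k) := by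
      rw [← Set.Ico_union_Ico_eq_Ico h4 hlt.le, Set.inter_union_distrib_left]
      congr 1
      exact Set.inter_eq_right.2 (Set.subset_iUnion (fun k =>
        Set.Ico (σ.start k) (I.completion σ k)) k)
    have h6 : Disjoint (U ∩ Set.Ico 0 (σ.start k))
        (Set.Ico (σ.start k) (I.completion σ k)) :=
      Set.Ico_disjoint_Ico_same.mono_left Set.inter_subset_right
    simp only [f]
    rw [h5, measureReal_union h6 measurableSet_Ico (hfin _) measure_Ico_lt_top.ne,
      Real.volume_real_Ico_of_le hlt.le]
    unfold completion
    ring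
  let σ' : Schedule P T := ⟨σ.proc, fun k => f (σ.start k)⟩
  have hc : ∀ k, I.completion σ' k = f (I.completion σ k) := fun k => (hrun k).symm
  refine ⟨σ', ⟨fun k => measureReal_nonneg, fun k' k hk => ?_, fun k' k hne hp => ?_⟩,
    fun k => ?_, fun k => ?_⟩
  · rw [hc]
    exact hmono (h.2.1 k' k hk)
  · rw [hc, hc]
    exact (h.2.2 k' k hne hp).imp (fun h => hmono h) fun h => hmono h
  · rw [hc]
    exact hle _ (zero_le_one.trans (h.one_le_completion k))
  · rw [hc]
    exact htot _

variable {I} in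
open MeasureTheory in
theorem Feasible.sum_p_le [Fintype T] {σ : Schedule P T} (h : I.Feasible σ) (i : P) {D : ℝ}
    (hD : 0 ≤ D) : ∑ k with σ.proc k = i ∧ I.completion σ k ≤ D, I.p i k ≤ D := by
  set S := univ.filter fun k => σ.proc k = i ∧ I.completion σ k ≤ D with hS
  have hmem : ∀ k ∈ S, σ.proc k = i ∧ I.completion σ k ≤ D := fun k hk => by simpa [hS] using hk
  have h1 : volume.real (⋃ k ∈ S, Set.Ico (σ.start k) (I.completion σ k)) = ∑ k ∈ S, I.p i k := by
    rw [measureReal_biUnion_finset ?_ (fun k _ => measurableSet_Ico)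
      fun _ _ => measure_Ico_lt_top.ne]
    · refine sum_congr rfl fun k hk => ?_
      have h3 := I.p_pos (σ.proc k) k
      rw [Real.volume_real_Ico_of_le (by unfold completion; linarith), ← (hmem k hk).1]
      unfold completion
      ring
    · intro a ha b hb hab
      rw [Function.onFun, Set.Ico_disjoint_Ico]
      rcases h.2.2 a b hab ((hmem a ha).1.trans (hmem b hb).1.symm) with h | h
      · exact (min_le_left _ _).trans (h.trans (le_max_right _ _))
      · exact (min_le_right _ _).trans (h.trans (le_max_left _ _))
  rw [← h1]
  calc _ ≤ volume.real (Set.Ico 0 D) := by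
        refine measureReal_mono (Set.iUnion₂_subset fun k hk => ?_) measure_Ico_lt_top.ne
        exact Set.Ico_subset_Ico (h.1 k) (hmem k hk).2
    _ = D := by rw [Real.volume_real_Ico_of_le hD, sub_zero]

theorem completion_le_jobCompletion [Finite T] (σ : Schedule P T) (k : T) :
    I.completion σ k ≤ I.jobCompletion σ (I.job k) :=
  le_ciSup (f := fun k' : {k' : T // I.job k' = I.job k} => I.completion σ k')
    (Set.finite_range _).bddAbove ⟨k, rfl⟩

theorem exists_job_eq (j : J) : ∃ k, I.job k = j := by
  obtain ⟨k, hk, -⟩ := I.exists_task j 1 true le_rfl (I.one_le_rounds j)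
  exact ⟨k, hk⟩

theorem jobCompletion_le (σ : Schedule P T) (j : J) (D : ℝ)
    (h : ∀ k, I.job k = j → I.completion σ k ≤ D) : I.jobCompletion σ j ≤ D := by
  obtain ⟨k, hk⟩ := I.exists_job_eq j
  have : Nonempty {k : T // I.job k = j} := ⟨⟨k, hk⟩⟩
  exact ciSup_le fun k => h k k.2

/-- Run everything on one processor, in an order refining the height. -/
theorem exists_feasible [Nonempty P] [Fintype T] : ∃ σ, I.Feasible σ := by
  obtain ⟨ord, hinj, hord⟩ := exists_injective_refinement I.height
  let i : P := Classical.arbitrary P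
  let σ : Schedule P T := ⟨fun _ => i, fun k => ∑ k' with ord k' < ord k, I.p i k'⟩
  have hlt : ∀ k' k, ord k' < ord k → I.completion σ k' ≤ σ.start k := by
    intro k' k h
    have : I.completion σ k' =
        ∑ a ∈ insert k' (univ.filter fun a => ord a < ord k'), I.p i a := by
      rw [sum_insert (by simp), add_comm]
      rfl
    rw [this]
    refine sum_le_sum_of_subset_of_nonneg (fun a ha => ?_) fun a _ _ => (I.p_pos i a).le
    simp at ha ⊢
    rcases ha with rfl | ha
    exacts [h, ha.trans h]
  refine ⟨σ, fun k => sum_nonneg fun a _ => (I.p_pos i a).le, fun k' k h => hlt k' k ?_,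
    fun k' k hne _ => ?_⟩
  · exact hord k' k (by rw [h.height_eq]; omega)
  · exact (lt_or_gt_of_ne (hinj.ne hne)).imp (hlt k' k) (hlt k k')

end Instance

/-! ### The linear program -/

namespace Instance

variable {P J T : Type*} (I : Instance P J T)

theorem numIntervals_spec [Fintype T] {δ : ℝ} (hδ : 0 < δ) :
    1 ≤ I.numIntervals δ ∧ I.tmax ≤ (1 + δ) ^ (I.numIntervals δ - 1) := by
  have hne : {L : ℕ | 1 ≤ L ∧ I.tmax ≤ (1 + δ) ^ (L - 1)}.Nonempty := by
    obtain ⟨n, hn⟩ := pow_unbounded_of_one_lt I.tmax (show 1 < 1 + δ by linarith)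
    exact ⟨n + 1, by simp, by simpa using hn.le⟩
  exact Nat.sInf_mem hne

theorem numIntervals_mem_intervals [Fintype T] {δ : ℝ} (hδ : 0 < δ) :
    I.numIntervals δ ∈ I.intervals δ :=
  mem_Icc.2 ⟨(I.numIntervals_spec hδ).1, le_rfl⟩

theorem massUpTo_of_numIntervals_le [Fintype T] (δ : ℝ) (s : LPSolution P J T) {ℓ : ℕ}
    (hℓ : I.numIntervals δ ≤ ℓ) (i : P) (k : T) :
    I.massUpTo δ s ℓ i k = ∑ t ∈ I.intervals δ, s.y i k t := by
  rw [massUpTo, filter_true_of_mem]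
  exact fun t ht => (mem_Icc.1 ht).2.trans hℓ

theorem exists_interval [Fintype T] {δ : ℝ} (hδ : 0 < δ) {C : ℝ} (hC : 1 ≤ C)
    (hC' : C ≤ I.tmax) :
    ∃ ℓ ∈ I.intervals δ, (1 + δ) ^ (ℓ - 1) ≤ C ∧ C ≤ (1 + δ) ^ ℓ := by
  obtain ⟨hL, hL'⟩ := I.numIntervals_spec hδ
  have hLC : C ≤ (1 + δ) ^ I.numIntervals δ :=
    (hC'.trans hL').trans (pow_le_pow_right₀ (by linarith) (Nat.sub_le _ _))
  have hex : ∃ ℓ, 1 ≤ ℓ ∧ C ≤ (1 + δ) ^ ℓ := ⟨_, hL, hLC⟩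
  refine ⟨Nat.find hex, mem_Icc.2 ⟨(Nat.find_spec hex).1, Nat.find_min' hex ⟨hL, hLC⟩⟩, ?_,
    (Nat.find_spec hex).2⟩
  -- The first interval has lower end 1; this is where completion times being at least 1 is needed.
  rcases (Nat.find_spec hex).1.eq_or_lt with h | h
  · rw [← h]; simpa using hC
  · have := Nat.find_min hex (Nat.sub_lt (by omega) one_pos)
    by_contra! hlt
    exact this ⟨by omega, hlt.le⟩

variable {I} in
/-- Every schedule yields a solution of the linear program of at most the same value. -/
theorem Feasible.exists_lpFeasible [Fintype P] [Fintype J] [Fintype T] {σ : Schedule P T}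
    (h : I.Feasible σ) {δ : ℝ} (hδ : 0 < δ) :
    ∃ s, I.LPFeasible δ s ∧ I.lpValue s ≤ I.cost σ := by
  obtain ⟨τ, hτ, hle, hmax⟩ := h.exists_completion_le_tmax
  choose c hc hcl hcu using fun k => I.exists_interval hδ (hτ.one_le_completion k) (hmax k)
  let s : LPSolution P J T :=
    ⟨fun i k t => if τ.proc k = i ∧ c k = t then 1 else 0, I.completion τ, I.jobCompletion τ⟩
  have hsum : ∀ i k (g : ℕ → ℝ), ∑ t ∈ I.intervals δ, g t * s.y i k t =
      if τ.proc k = i then g (c k) else 0 := by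
    intro i k g
    by_cases hi : τ.proc k = i
    · simp [s, hi, hc k]
    · simp [s, hi]
  have hsum1 : ∀ i k, ∑ t ∈ I.intervals δ, s.y i k t = if τ.proc k = i then 1 else 0 := by
    intro i k
    simpa using hsum i k (fun _ => 1)
  have hmass : ∀ ℓ i k, I.massUpTo δ s ℓ i k = if τ.proc k = i ∧ c k ≤ ℓ then 1 else 0 := by
    intro ℓ i k
    have := hsum i k (fun t => if t ≤ ℓ then 1 else 0)
    rw [massUpTo, sum_filter]
    simpa [ite_and] using this
  refine ⟨s, ⟨fun k => ?_, fun k => ?_, fun k' k hk => ?_, fun k => ?_, fun i ℓ _ => ?_,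
    fun i k ℓ _ hlt => ?_, fun i k ℓ _ => ?_⟩, ?_⟩
  · simp [hsum1]
  · exact I.completion_le_jobCompletion τ k
  · have h1 := hτ.2.1 k' k hk
    simp only [hsum1, mul_ite, mul_one, mul_zero, sum_ite_eq, mem_univ, if_true]
    change _ ≤ τ.start k + _
    change I.completion τ k' + _ ≤ _
    linarith
  · simp only [hsum, sum_ite_eq, mem_univ, if_true]
    exact hcl k
  -- Tasks counted up to `ℓ` complete by `(1+δ)^ℓ` and are executed disjointly on `i`.
  · simp only [hmass, mul_ite, mul_one, mul_zero, ← sum_filter]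
    refine le_trans (sum_le_sum_of_subset_of_nonneg (fun k hk => ?_) fun k _ _ =>
      (I.p_pos i k).le) (hτ.sum_p_le i (by positivity : 0 ≤ (1 + δ) ^ ℓ))
    simp at hk ⊢
    exact ⟨hk.1, (hcu k).trans (pow_le_pow_right₀ (by linarith) hk.2)⟩
  · refine if_neg ?_
    rintro ⟨rfl, rfl⟩
    have h1 := hτ.1 k
    have h2 := hcu k
    unfold completion at h2
    linarith
  · change 0 ≤ ite _ _ _
    split_ifs <;> norm_num
  · refine sum_le_sum fun j _ => mul_le_mul_of_nonneg_left ?_ (I.w_nonneg j)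
    refine I.jobCompletion_le τ j _ fun k hk => (hle k).trans ?_
    rw [← hk]
    exact I.completion_le_jobCompletion σ k

/-! ### Existence of an LP optimum by compactness -/

namespace LPFeasible

variable {I} [Fintype P] [Fintype T] {δ : ℝ} {s : LPSolution P J T}

theorem one_le_Ctask (h : I.LPFeasible δ s) (hδ : 0 < δ) (k : T) : 1 ≤ s.Ctask k := by
  refine ((h.assigned k).trans (sum_le_sum fun i _ => sum_le_sum fun t ht => ?_)).trans
    (h.interval_le k)
  exact le_mul_of_one_le_left (h.y_nonneg i k t ht) (one_le_pow₀ (by linarith))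

theorem massUpTo_nonneg (h : I.LPFeasible δ s) (ℓ : ℕ) (i : P) (k : T) :
    0 ≤ I.massUpTo δ s ℓ i k :=
  sum_nonneg fun t ht => h.y_nonneg i k t (mem_filter.1 ht).1

theorem p_mul_sum_le (h : I.LPFeasible δ s) (hδ : 0 < δ) (i : P) (k : T) :
    I.p i k * ∑ t ∈ I.intervals δ, s.y i k t ≤ (1 + δ) ^ I.numIntervals δ := by
  rw [← I.massUpTo_of_numIntervals_le δ s le_rfl]
  exact (single_le_sum (f := fun k => I.p i k * I.massUpTo δ s (I.numIntervals δ) i k)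
    (fun k _ => mul_nonneg (I.p_pos i k).le (h.massUpTo_nonneg _ i k)) (mem_univ k)).trans
    (h.load i _ (I.numIntervals_mem_intervals hδ))

theorem sum_nonneg (h : I.LPFeasible δ s) (i : P) (k : T) :
    0 ≤ ∑ t ∈ I.intervals δ, s.y i k t :=
  Finset.sum_nonneg fun t ht => h.y_nonneg i k t ht

theorem sum_le (h : I.LPFeasible δ s) (hδ : 0 < δ) (i : P) (k : T) :
    ∑ t ∈ I.intervals δ, s.y i k t ≤ (1 + δ) ^ I.numIntervals δ :=
  (le_mul_of_one_le_left (h.sum_nonneg i k) (I.one_le_p i k)).trans (h.p_mul_sum_le hδ i k)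

/-- A solution can be cut down to a box without increasing its value. -/
theorem exists_bounded [Fintype J] (h : I.LPFeasible δ s) (hδ : 0 < δ) {q B : ℝ}
    (hq : q = (1 + δ) ^ I.numIntervals δ) (hB : B = Fintype.card P * (q * q)) :
    ∃ s', I.LPFeasible δ s' ∧ I.lpValue s' ≤ I.lpValue s ∧ (∀ i k ℓ, s'.y i k ℓ ∈ Set.Icc 0 q) ∧
      (∀ k, s'.Ctask k ∈ Set.Icc 0 (2 * I.rmax * B)) ∧
      ∀ j, s'.Cjob j ∈ Set.Icc 0 (2 * I.rmax * B) := by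
  have hq1 : 1 ≤ q := hq ▸ one_le_pow₀ (by linarith)
  have hB0 : 0 ≤ B := by rw [hB]; positivity
  have hlen : ∀ k, ∑ i, I.p i k * ∑ ℓ ∈ I.intervals δ, s.y i k ℓ ≤ B := by
    intro k
    calc _ ≤ ∑ _i : P, q := sum_le_sum fun i _ => hq ▸ h.p_mul_sum_le hδ i k
      _ = Fintype.card P * q := by simp
      _ ≤ B := by
        rw [hB]
        exact mul_le_mul_of_nonneg_left (le_mul_of_one_le_left (by linarith) hq1) (by positivity)
  have hint : ∀ k, ∑ i, ∑ ℓ ∈ I.intervals δ, (1 + δ) ^ (ℓ - 1) * s.y i k ℓ ≤ B := by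
    intro k
    calc _ ≤ ∑ _i : P, q * q := sum_le_sum fun i _ => by
          refine le_trans (sum_le_sum fun t ht => ?_) ((mul_sum _ _ q).symm.le.trans
            (mul_le_mul_of_nonneg_left (hq ▸ h.sum_le hδ i k) (by linarith)))
          refine mul_le_mul_of_nonneg_right ?_ (h.y_nonneg i k t ht)
          rw [hq]
          exact pow_le_pow_right₀ (by linarith) ((Nat.sub_le _ _).trans (mem_Icc.1 ht).2)
      _ = B := by simp [hB]
  have hH : ∀ k, ((I.height k : ℝ) + 1) * B ≤ 2 * I.rmax * B := fun k =>
    mul_le_mul_of_nonneg_right (by exact_mod_cast I.height_lt_two_mul_rmax k) hB0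
  have hC0 : ∀ k, 0 ≤ s.Ctask k := fun k => zero_le_one.trans (h.one_le_Ctask hδ k)
  -- `B` bounds the fractional length of a task and the left side of its interval constraint. Since
  -- height grows by one along an edge, capping `Ctask` at `(height + 1) * B` preserves the
  -- precedence constraints. The unused values of `y` are unconstrained and are set to 0.
  let s' : LPSolution P J T :=
    ⟨fun i k ℓ => if ℓ ∈ I.intervals δ then s.y i k ℓ else 0,
      fun k => min (s.Ctask k) ((I.height k + 1) * B), fun j => min (s.Cjob j) (2 * I.rmax * B)⟩
  have hy : ∀ i k, ∀ ℓ ∈ I.intervals δ, s'.y i k ℓ = s.y i k ℓ := fun i k ℓ hℓ => if_pos hℓ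
  have hsum : ∀ i k, ∑ ℓ ∈ I.intervals δ, s'.y i k ℓ = ∑ ℓ ∈ I.intervals δ, s.y i k ℓ :=
    fun i k => sum_congr rfl (hy i k)
  have hmass : ∀ ℓ i k, I.massUpTo δ s' ℓ i k = I.massUpTo δ s ℓ i k :=
    fun ℓ i k => sum_congr rfl fun t ht => hy i k t (mem_filter.1 ht).1
  refine ⟨s', ⟨fun k => ?_, fun k => ?_, fun k' k hk => ?_, fun k => ?_, fun i ℓ hℓ => ?_,
    fun i k ℓ hℓ hlt => ?_, fun i k ℓ hℓ => ?_⟩, ?_, fun i k ℓ => ?_, fun k => ?_, fun j => ?_⟩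
  · simpa only [hsum] using h.assigned k
  · exact min_le_min (h.job_ge_task k) (hH k)
  · simp only [hsum]
    have h1 := h.precedence k' k hk
    have h2 := hlen k
    change min _ _ + _ ≤ min _ _
    rw [hk.height_eq, min_add]
    push_cast
    exact min_le_min h1 (by linarith)
  · refine (sum_congr rfl fun i _ => sum_congr rfl fun ℓ hℓ => by rw [hy i k ℓ hℓ]).le.trans ?_
    refine le_min (h.interval_le k) ((hint k).trans (le_mul_of_one_le_left hB0 ?_))
    linarith [(Nat.cast_nonneg (I.height k) : (0 : ℝ) ≤ _)]
  · simpa only [hmass] using h.load i ℓ hℓ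
  · rw [hy i k ℓ hℓ]
    exact h.too_long i k ℓ hℓ hlt
  · rw [hy i k ℓ hℓ]
    exact h.y_nonneg i k ℓ hℓ
  · exact sum_le_sum fun j _ => mul_le_mul_of_nonneg_left (min_le_left _ _) (I.w_nonneg j)
  · by_cases hℓ : ℓ ∈ I.intervals δ
    · rw [hy i k ℓ hℓ]
      exact ⟨h.y_nonneg i k ℓ hℓ, (single_le_sum (f := s.y i k) (h.y_nonneg i k) hℓ).trans
        (hq ▸ h.sum_le hδ i k)⟩
    · have : s'.y i k ℓ = 0 := if_neg hℓ
      rw [this]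
      exact ⟨le_rfl, by linarith⟩
  · exact ⟨le_min (hC0 k) (by positivity), (min_le_right _ _).trans (hH k)⟩
  · obtain ⟨k, rfl⟩ := I.exists_job_eq j
    exact ⟨le_min ((hC0 k).trans (h.job_ge_task k)) (by positivity), min_le_right _ _⟩

end LPFeasible

theorem exists_lpOptimal [Fintype P] [Nonempty P] [Fintype J] [Fintype T] {δ : ℝ} (hδ : 0 < δ) :
    ∃ s, I.LPOptimal δ s := by
  obtain ⟨σ, hσ⟩ := I.exists_feasible
  obtain ⟨s₀, hs₀, -⟩ := hσ.exists_lpFeasible hδ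
  let q := (1 + δ) ^ I.numIntervals δ
  let H := 2 * I.rmax * ((Fintype.card P : ℝ) * (q * q))
  -- Compact although `ℓ` ranges over all of `ℕ`, being an order interval in a product of copies of
  -- `ℝ`.
  let box : Set ((P → T → ℕ → ℝ) × (T → ℝ) × (J → ℝ)) :=
    Set.Icc (0, 0, 0) (fun _ _ _ => q, fun _ => H, fun _ => H)
  let toLP : (P → T → ℕ → ℝ) × (T → ℝ) × (J → ℝ) → LPSolution P J T :=
    fun v => ⟨v.1, v.2.1, v.2.2⟩
  have hclosed : IsClosed {v | I.LPFeasible δ (toLP v)} := by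
    have : {v | I.LPFeasible δ (toLP v)} =
        {v | ∀ k, 1 ≤ ∑ i, ∑ ℓ ∈ I.intervals δ, v.1 i k ℓ} ∩
        {v | ∀ k, v.2.1 k ≤ v.2.2 (I.job k)} ∩
        {v | ∀ k' k, I.Prec k' k →
          v.2.1 k' + ∑ i, I.p i k * ∑ ℓ ∈ I.intervals δ, v.1 i k ℓ ≤ v.2.1 k} ∩
        {v | ∀ k, ∑ i, ∑ ℓ ∈ I.intervals δ, (1 + δ) ^ (ℓ - 1) * v.1 i k ℓ ≤ v.2.1 k} ∩
        {v | ∀ i, ∀ ℓ ∈ I.intervals δ,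
          ∑ k, I.p i k * ∑ t ∈ I.intervals δ with t ≤ ℓ, v.1 i k t ≤ (1 + δ) ^ ℓ} ∩
        {v | ∀ i k, ∀ ℓ ∈ I.intervals δ, (1 + δ) ^ ℓ < I.p i k → v.1 i k ℓ = 0} ∩
        {v | ∀ i k, ∀ ℓ ∈ I.intervals δ, 0 ≤ v.1 i k ℓ} := by
      ext v
      constructor
      · rintro ⟨h1, h2, h3, h4, h5, h6, h7⟩
        exact ⟨⟨⟨⟨⟨⟨h1, h2⟩, h3⟩, h4⟩, h5⟩, h6⟩, h7⟩
      · rintro ⟨⟨⟨⟨⟨⟨h1, h2⟩, h3⟩, h4⟩, h5⟩, h6⟩, h7⟩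
        exact ⟨h1, h2, h3, h4, h5, h6, h7⟩
    rw [this]
    simp only [Set.ofPred_forall]
    repeat' apply IsClosed.inter
    all_goals repeat' (refine isClosed_iInter fun _ => ?_)
    all_goals first
      | exact isClosed_le (by fun_prop) (by fun_prop)
      | exact isClosed_eq (by fun_prop) (by fun_prop)
  have hcont : Continuous fun v => I.lpValue (toLP v) := by
    have : Continuous fun v : (P → T → ℕ → ℝ) × (T → ℝ) × (J → ℝ) => ∑ j, I.w j * v.2.2 j := by
      fun_prop
    exact this
  have hbox : ∀ s, I.LPFeasible δ s → ∃ v ∈ box ∩ {v | I.LPFeasible δ (toLP v)},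
      I.lpValue (toLP v) ≤ I.lpValue s := by
    intro s hs
    obtain ⟨s', h1, h2, h3, h4, h5⟩ := hs.exists_bounded hδ (q := q) rfl rfl
    exact ⟨(s'.y, s'.Ctask, s'.Cjob), ⟨⟨⟨fun i k ℓ => (h3 i k ℓ).1, fun k => (h4 k).1,
      fun j => (h5 j).1⟩, fun i k ℓ => (h3 i k ℓ).2, fun k => (h4 k).2, fun j => (h5 j).2⟩, h1⟩, h2⟩
  obtain ⟨v₀, hv₀, -⟩ := hbox s₀ hs₀
  obtain ⟨v, hv, hmin⟩ := (isCompact_Icc.inter_right hclosed).exists_isMinOn ⟨v₀, hv₀⟩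
    hcont.continuousOn
  refine ⟨toLP v, hv.2, fun s hs => ?_⟩
  obtain ⟨v', hv', hle⟩ := hbox s hs
  exact (hmin hv').trans hle

end Instance

/-! ### The fractional assignment of a bucket -/

namespace Instance

variable {P J T : Type*} {I : Instance P J T}

namespace LPFeasible

variable [Fintype P] [Fintype T] {α δ : ℝ} {s : LPSolution P J T}

theorem Ctask_le_of_prec (h : I.LPFeasible δ s) {k' k : T} (hk : I.Prec k' k) :
    s.Ctask k' ≤ s.Ctask k :=
  (le_add_of_nonneg_right (Finset.sum_nonneg fun i _ =>
    mul_nonneg (I.p_pos i k).le (h.sum_nonneg i k))).trans (h.precedence k' k hk)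

theorem massUpTo_mono (h : I.LPFeasible δ s) {ℓ ℓ' : ℕ} (hℓ : ℓ ≤ ℓ') (i : P) (k : T) :
    I.massUpTo δ s ℓ i k ≤ I.massUpTo δ s ℓ' i k := by
  refine sum_le_sum_of_subset_of_nonneg (fun t ht => ?_) fun t ht _ =>
    h.y_nonneg i k t (mem_filter.1 ht).1
  rw [mem_filter] at ht ⊢
  exact ⟨ht.1, ht.2.trans hℓ⟩

/-- Bucket indices may exceed `L`, because they are defined through `α * Ctask`; beyond `L` the mass
no longer grows. -/
theorem load_le (h : I.LPFeasible δ s) (hδ : 0 < δ) (i : P) {ℓ : ℕ} (hℓ : 1 ≤ ℓ) :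
    ∑ k, I.p i k * I.massUpTo δ s ℓ i k ≤ (1 + δ) ^ ℓ := by
  rcases le_total ℓ (I.numIntervals δ) with hL | hL
  · exact h.load i ℓ (mem_Icc.2 ⟨hℓ, hL⟩)
  · have h1 := h.load i _ (I.numIntervals_mem_intervals hδ)
    simp only [I.massUpTo_of_numIntervals_le δ s le_rfl] at h1
    simp only [I.massUpTo_of_numIntervals_le δ s hL]
    exact h1.trans (pow_le_pow_right₀ (by linarith) hL)

/-- Markov's inequality: mass `R` beyond `ℓ` contributes at least `(1+δ)^ℓ * R` to the lower bound
on `Ctask k`, whereas `α * Ctask k < (1+δ)^ℓ`. -/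
theorem one_sub_inv_le_sum_massUpTo (h : I.LPFeasible δ s) (hδ : 0 < δ) (hα : 1 < α) {k : T}
    {ℓ : ℕ} (hk : k ∈ bucket α δ s ℓ) : 1 - 1 / α ≤ ∑ i, I.massUpTo δ s ℓ i k := by
  set R := ∑ i, ∑ t ∈ I.intervals δ with ¬ t ≤ ℓ, s.y i k t with hR
  have hsplit : ∑ i, ∑ t ∈ I.intervals δ, s.y i k t = ∑ i, I.massUpTo δ s ℓ i k + R := by
    rw [hR, ← sum_add_distrib]
    exact sum_congr rfl fun i _ => (sum_filter_add_sum_filter_not _ _ _).symm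
  have hR0 : 0 ≤ R := Finset.sum_nonneg fun i _ => Finset.sum_nonneg fun t ht =>
    h.y_nonneg i k t (mem_filter.1 ht).1
  have hC := h.one_le_Ctask hδ k
  have hRC : (1 + δ) ^ ℓ * R ≤ s.Ctask k := by
    rw [hR, mul_sum]
    refine (sum_le_sum fun i _ => ?_).trans (h.interval_le k)
    rw [mul_sum]
    refine (sum_le_sum fun t ht => ?_).trans (sum_le_sum_of_subset_of_nonneg
      (filter_subset _ _) fun t ht _ => mul_nonneg (by positivity) (h.y_nonneg i k t ht))
    rw [mem_filter] at ht
    exact mul_le_mul_of_nonneg_right (pow_le_pow_right₀ (by linarith) (by omega))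
      (h.y_nonneg i k t ht.1)
  have h1 : R * α ≤ 1 := by
    have h2 := mul_le_mul_of_nonneg_right hk.2.2.le hR0
    by_contra! h3
    nlinarith
  have h4 : R ≤ 1 / α := (le_div_iff₀ (by linarith)).2 h1
  have h5 := h.assigned k
  linarith

theorem sum_massUpTo_pos (h : I.LPFeasible δ s) (hδ : 0 < δ) (hα : 1 < α) {k : T} {ℓ : ℕ}
    (hk : k ∈ bucket α δ s ℓ) : 0 < ∑ i, I.massUpTo δ s ℓ i k := by
  have h1 : 1 / α < 1 := (div_lt_one (by linarith)).2 hα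
  linarith [h.one_sub_inv_le_sum_massUpTo hδ hα hk]

theorem fracAssign_nonneg (h : I.LPFeasible δ s) (ℓ : ℕ) (i : P) (k : T) :
    0 ≤ I.fracAssign δ s ℓ i k :=
  div_nonneg (h.massUpTo_nonneg ℓ i k) (Finset.sum_nonneg fun i _ => h.massUpTo_nonneg ℓ i k)

theorem sum_fracAssign (h : I.LPFeasible δ s) (hδ : 0 < δ) (hα : 1 < α) {k : T} {ℓ : ℕ}
    (hk : k ∈ bucket α δ s ℓ) : ∑ i, I.fracAssign δ s ℓ i k = 1 := by
  simp only [fracAssign]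
  rw [← sum_div, div_self (h.sum_massUpTo_pos hδ hα hk).ne']

theorem fracAssign_le (h : I.LPFeasible δ s) (hδ : 0 < δ) (hα : 1 < α) {k : T} {ℓ : ℕ}
    (hk : k ∈ bucket α δ s ℓ) (i : P) :
    I.fracAssign δ s ℓ i k ≤ α / (α - 1) * I.massUpTo δ s ℓ i k := by
  have h0 : 0 < α - 1 := by linarith
  have h1 := h.one_sub_inv_le_sum_massUpTo hδ hα hk
  rw [fracAssign, div_le_iff₀ (h.sum_massUpTo_pos hδ hα hk)]
  have h2 : 1 ≤ α / (α - 1) * ∑ i, I.massUpTo δ s ℓ i k := by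
    refine le_trans (le_of_eq ?_) (mul_le_mul_of_nonneg_left h1 (by positivity))
    field_simp
  nlinarith [h.massUpTo_nonneg ℓ i k]

theorem p_le_of_fracAssign_pos (h : I.LPFeasible δ s) (hδ : 0 < δ) {ℓ : ℕ} {i : P} {k : T}
    (hx : 0 < I.fracAssign δ s ℓ i k) : I.p i k ≤ (1 + δ) ^ ℓ := by
  by_contra! hlt
  refine hx.ne' ?_
  have : I.massUpTo δ s ℓ i k = 0 := sum_eq_zero fun t ht => by
    rw [mem_filter] at ht
    exact h.too_long i k t ht.1 ((pow_le_pow_right₀ (by linarith) ht.2).trans_lt hlt)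
  rw [fracAssign, this, zero_div]

/-- Mass up to a task's own bucket is at most its mass up to `ℓ`, so one load constraint controls
all buckets up to `ℓ` simultaneously. -/
theorem sum_p_mul_fracAssign_le (h : I.LPFeasible δ s) (hδ : 0 < δ) (hα : 1 < α) {b : T → ℕ}
    (hb : ∀ k, k ∈ bucket α δ s (b k)) (i : P) {ℓ : ℕ} (hℓ : 1 ≤ ℓ) :
    ∑ k with b k ≤ ℓ, I.p i k * I.fracAssign δ s (b k) i k ≤ α / (α - 1) * (1 + δ) ^ ℓ := by
  have hA : 0 ≤ α / (α - 1) := div_nonneg (by linarith) (by linarith)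
  refine le_trans ?_ (mul_le_mul_of_nonneg_left (h.load_le hδ i hℓ) hA)
  rw [mul_sum]
  refine le_trans (sum_le_sum fun k hk => ?_) (sum_le_sum_of_subset_of_nonneg (filter_subset _ _)
    fun k _ _ => mul_nonneg hA (mul_nonneg (I.p_pos i k).le (h.massUpTo_nonneg ℓ i k)))
  calc _ ≤ I.p i k * (α / (α - 1) * I.massUpTo δ s ℓ i k) := by
        refine mul_le_mul_of_nonneg_left ?_ (I.p_pos i k).le
        exact (h.fracAssign_le hδ hα (hb k) i).trans
          (mul_le_mul_of_nonneg_left (h.massUpTo_mono (mem_filter.1 hk).2 i k) hA)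
    _ = _ := by ring

end LPFeasible

/-! ### The greedy schedule -/

variable (I) in
/-- Starting times when the tasks are placed in the order of `ord` as early as possible. -/
noncomputable def greedyStart (ord : T → ℕ) (proc : T → P) (k : T) : ℝ :=
  sInf {τ : ℝ | 0 ≤ τ ∧
    (∀ k', (_ : ord k' < ord k) → I.Prec k' k → greedyStart ord proc k' + I.p (proc k') k' ≤ τ) ∧
    ∀ k', (_ : ord k' < ord k) → proc k' = proc k →
      greedyStart ord proc k' + I.p (proc k') k' ≤ τ ∨
        τ + I.p (proc k) k ≤ greedyStart ord proc k'}
termination_by ord k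
decreasing_by all_goals assumption

/-- Predecessors come earlier in `ord`, so the restriction that makes the recursion well founded
loses nothing. The admissible set is closed, nonempty and bounded below, so its infimum is attained.
-/
theorem isLeast_greedyStart [Finite T] {ord : T → ℕ} (hord : ∀ k' k, I.Prec k' k → ord k' < ord k)
    {σ : Schedule P T} (hσ : σ.start = I.greedyStart ord σ.proc) (k : T) :
    IsLeast {τ : ℝ | 0 ≤ τ ∧ (∀ k', I.Prec k' k → I.completion σ k' ≤ τ) ∧
        ∀ k', ord k' < ord k → σ.proc k' = σ.proc k →
          I.completion σ k' ≤ τ ∨ τ + I.p (σ.proc k) k ≤ σ.start k'} (σ.start k) := by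
  set A := {τ : ℝ | 0 ≤ τ ∧ (∀ k', I.Prec k' k → I.completion σ k' ≤ τ) ∧
        ∀ k', ord k' < ord k → σ.proc k' = σ.proc k →
          I.completion σ k' ≤ τ ∨ τ + I.p (σ.proc k) k ≤ σ.start k'} with hA
  have hstart : σ.start k = sInf A := by
    rw [hσ, greedyStart, hA]
    simp only [completion, hσ]
    congr 1
    ext τ
    exact and_congr_right fun _ => and_congr_left fun _ =>
      ⟨fun h k' hk => h k' (hord k' k hk) hk, fun h k' _ hk => h k' hk⟩
  rw [hstart]
  refine IsClosed.isLeast_csInf ?_ ?_ ⟨0, fun τ hτ => hτ.1⟩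
  · simp only [hA, Set.ofPred_and, Set.ofPred_forall, Set.ofPred_or]
    refine isClosed_Ici.inter (IsClosed.inter ?_ ?_)
    · exact isClosed_iInter fun _ => isClosed_iInter fun _ => isClosed_Ici
    · exact isClosed_iInter fun _ => isClosed_iInter fun _ => isClosed_iInter fun _ =>
        isClosed_Ici.union (isClosed_le (by fun_prop) (by fun_prop))
  · obtain ⟨D, hD⟩ := (Set.finite_range (I.completion σ)).bddAbove
    exact ⟨max D 0, le_max_right _ _, fun k' _ => (hD ⟨k', rfl⟩).trans (le_max_left _ _),
      fun k' _ _ => Or.inl ((hD ⟨k', rfl⟩).trans (le_max_left _ _))⟩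

theorem LPFeasible.exists_isOutput [Fintype P] [Nonempty P] [Fintype T] {α δ : ℝ}
    {s : LPSolution P J T} (h : I.LPFeasible δ s) (hδ : 0 < δ) (hα : 1 < α) :
    ∃ σ, I.IsOutput α δ s σ := by
  obtain ⟨b, n, hbn⟩ := I.exists_level_indices hα.le hδ (h.one_le_Ctask hδ)
  have hlev : ∀ k, k ∈ I.level α δ s (b k) (n k) := fun k => (hbn k _ _).2 ⟨rfl, rfl⟩
  choose f hf using fun ℓ m => exists_isShmoysTardosRounding I.p (I.fracAssign δ s ℓ)
    (I.level α δ s ℓ m) (fun i k _ => h.fracAssign_nonneg ℓ i k)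
    fun k hk => h.sum_fracAssign hδ hα (I.mem_bucket_of_mem_level hk)
  obtain ⟨M, hM⟩ : ∃ M, ∀ k, n k < M := by
    obtain ⟨M, hM⟩ := (Set.finite_range n).bddAbove
    exact ⟨M + 1, fun k => Nat.lt_succ_of_le (hM ⟨k, rfl⟩)⟩
  obtain ⟨ord, hinj, hord⟩ := exists_injective_refinement fun k => b k * M + n k
  have hlt : ∀ k' k, (b k' < b k ∨ b k' = b k ∧ n k' < n k) → ord k' < ord k := by
    intro k' k hk
    refine hord k' k ?_
    rcases hk with hk | ⟨h1, h2⟩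
    · have := Nat.mul_le_mul_right M hk
      rw [Nat.succ_mul] at this
      have := hM k'
      omega
    · rw [h1]; omega
  have hprec : ∀ k' k, I.Prec k' k → ord k' < ord k := by
    intro k' k hk
    refine hlt k' k ?_
    rcases (bucket_index_mono (by linarith) hδ (I.mem_bucket_of_mem_level (hlev k'))
      (I.mem_bucket_of_mem_level (hlev k)) (h.Ctask_le_of_prec hk)).lt_or_eq with hb | hb
    · exact Or.inl hb
    · refine Or.inr ⟨hb, decompose_index_lt (hlev k') ?_ hk⟩
      rw [hb]
      exact hlev k
  let proc : T → P := fun k => f (b k) (n k) k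
  refine ⟨⟨proc, I.greedyStart ord proc⟩, fun ℓ m => ?_, ord, hinj, ?_,
    isLeast_greedyStart hprec rfl⟩
  · obtain ⟨rank, h1, h2, slot, h3, h4⟩ := hf ℓ m
    have hp : ∀ k ∈ I.level α δ s ℓ m, proc k = f ℓ m k := by
      intro k hk
      obtain ⟨rfl, rfl⟩ := (hbn k ℓ m).1 hk
      rfl
    refine ⟨rank, h1, h2, slot, fun k hk k' hk' hkk' => h3 hk hk' ?_, fun k hk => ?_⟩
    · simpa only [hp k hk, hp k' hk'] using hkk'
    · simpa only [hp k hk] using h4 k hk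
  · intro ℓ m ℓ' m' k hk k' hk' hcmp
    obtain ⟨rfl, rfl⟩ := (hbn k ℓ m).1 hk
    obtain ⟨rfl, rfl⟩ := (hbn k' ℓ' m').1 hk'
    exact hlt k k' hcmp

theorem IsOutput.feasible [Fintype P] [Fintype T] {α δ : ℝ} {s : LPSolution P J T}
    {σ : Schedule P T} (h : I.IsOutput α δ s σ) : I.Feasible σ := by
  obtain ⟨-, ord, hinj, -, hleast⟩ := h
  refine ⟨fun k => (hleast k).1.1, fun k' k hk => (hleast k).1.2.1 k' hk, fun k' k hne hp => ?_⟩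
  rcases lt_or_gt_of_ne (hinj.ne hne) with hlt | hlt
  · exact (hleast k).1.2.2 k' hlt hp
  · exact ((hleast k').1.2.2 k hlt hp.symm).symm

end Instance

/-! ### Analysis of the greedy schedule -/

/-- Each bucket owns `M` consecutive level numbers; those below `M` belong to the empty bucket 0. -/
theorem sum_Ico_pow_div (q : ℝ) (M ℓ : ℕ) :
    ∑ m ∈ Ico M ((ℓ + 1) * M), q ^ (m / M) = M * ∑ t ∈ Ico 1 (ℓ + 1), q ^ t := by
  rcases M.eq_zero_or_pos with rfl | hM
  · simp
  induction ℓ with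
  | zero => simp
  | succ ℓ ih =>
    rw [← sum_Ico_consecutive _ (Nat.le_mul_of_pos_left M (Nat.succ_pos ℓ))
      (Nat.mul_le_mul_right M (Nat.le_succ (ℓ + 1))), ih,
      sum_Ico_succ_top (show 1 ≤ ℓ + 1 by omega), mul_add]
    congr 1
    have : ∀ m ∈ Ico ((ℓ + 1) * M) ((ℓ + 1 + 1) * M), q ^ (m / M) = q ^ (ℓ + 1) := by
      intro m hm
      rw [mem_Ico] at hm
      rw [Nat.div_eq_of_lt_le hm.1 hm.2]
    rw [sum_congr rfl this, sum_const, Nat.card_Ico, nsmul_eq_mul, Nat.succ_mul (ℓ + 1),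
      Nat.add_sub_cancel_left]

theorem mul_sum_Ico_pow_le {δ : ℝ} (hδ : 0 < δ) (ℓ : ℕ) :
    δ * ∑ t ∈ Ico 1 ℓ, (1 + δ) ^ t ≤ (1 + δ) ^ ℓ := by
  induction ℓ with
  | zero => simp
  | succ ℓ ih =>
    rcases ℓ.eq_zero_or_pos with rfl | hℓ
    · simp; linarith
    · rw [sum_Ico_succ_top hℓ, pow_succ]
      linarith

namespace Instance

variable {P J T : Type*} {I : Instance P J T}

/-- Either a task `k` is never delayed by a predecessor but only by the tasks of its processor, or
its delay is due to some predecessor `k₁` of a task `k₀` and to tasks of its processor that are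
placed between `k₀` and `k`. -/
theorem exists_completion_le [Fintype T] {σ : Schedule P T} {ord : T → ℕ}
    (hleast : ∀ k, IsLeast {τ : ℝ | 0 ≤ τ ∧ (∀ k', I.Prec k' k → I.completion σ k' ≤ τ) ∧
        ∀ k', ord k' < ord k → σ.proc k' = σ.proc k →
          I.completion σ k' ≤ τ ∨ τ + I.p (σ.proc k) k ≤ σ.start k'} (σ.start k)) (i : P) (k : T)
    (hk : σ.proc k = i) :
    ∃ k₀, σ.proc k₀ = i ∧ ord k₀ ≤ ord k ∧ ∃ c : ℝ, (c = 0 ∨ ∃ k₁, I.Prec k₁ k₀ ∧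
      c = I.completion σ k₁) ∧ I.completion σ k ≤
        c + ∑ k' with σ.proc k' = i ∧ ord k₀ ≤ ord k' ∧ ord k' ≤ ord k, I.p i k' := by
  induction hn : ord k using Nat.strong_induction_on generalizing k with
  | _ n ih =>
  subst hn
  have hself : I.p i k ≤
      ∑ k' with σ.proc k' = i ∧ ord k ≤ ord k' ∧ ord k' ≤ ord k, I.p i k' :=
    single_le_sum (f := I.p i) (fun k' _ => (I.p_pos i k').le) (by simp [hk])
  have hc : I.completion σ k = σ.start k + I.p i k := by rw [completion, hk]
  -- All tasks that can delay `k`. Starting at the last completion among them is admissible, so by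
  -- minimality `k` starts no later; a predecessor ends the tracing, a task of the same processor
  -- continues it.
  let S : Finset T := univ.filter fun k' => I.Prec k' k ∨ ord k' < ord k ∧ σ.proc k' = i
  rcases S.eq_empty_or_nonempty with h0 | hne
  · have hS : ∀ k', ¬ (I.Prec k' k ∨ ord k' < ord k ∧ σ.proc k' = i) := fun k' h =>
      notMem_empty k' (h0 ▸ mem_filter.2 ⟨mem_univ _, h⟩)
    have : σ.start k ≤ 0 := (hleast k).2 ⟨le_rfl, fun k' h => absurd (Or.inl h) (hS k'),
      fun k' h1 h2 => absurd (Or.inr ⟨h1, h2.trans hk⟩) (hS k')⟩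
    exact ⟨k, hk, le_rfl, 0, Or.inl rfl, by linarith⟩
  obtain ⟨m, hm, hmax⟩ := exists_max_image S (I.completion σ) hne
  have hm0 : 0 ≤ I.completion σ m := add_nonneg (hleast m).1.1 (I.p_pos _ _).le
  have hstart : σ.start k ≤ I.completion σ m := (hleast k).2 ⟨hm0,
    fun k' h => hmax k' (mem_filter.2 ⟨mem_univ _, Or.inl h⟩),
    fun k' h1 h2 => Or.inl (hmax k' (mem_filter.2 ⟨mem_univ _, Or.inr ⟨h1, h2.trans hk⟩⟩))⟩
  rcases (mem_filter.1 hm).2 with hprec | ⟨hlt, hproc⟩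
  · exact ⟨k, hk, le_rfl, _, Or.inr ⟨m, hprec, rfl⟩, by linarith⟩
  · obtain ⟨k₀, h1, h2, c, h3, h4⟩ := ih (ord m) hlt m hproc rfl
    refine ⟨k₀, h1, h2.trans hlt.le, c, h3, ?_⟩
    have h5 : ∑ k' with σ.proc k' = i ∧ ord k₀ ≤ ord k' ∧ ord k' ≤ ord m, I.p i k' + I.p i k ≤
        ∑ k' with σ.proc k' = i ∧ ord k₀ ≤ ord k' ∧ ord k' ≤ ord k, I.p i k' := by
      rw [add_comm, ← sum_insert (by simp; omega)]
      refine sum_le_sum_of_subset_of_nonneg (fun k' hk' => ?_) fun k' _ _ => (I.p_pos i k').le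
      simp only [mem_insert, mem_filter, mem_univ, true_and] at hk' ⊢
      rcases hk' with rfl | ⟨a1, a2, a3⟩
      · exact ⟨hk, h2.trans hlt.le, le_rfl⟩
      · exact ⟨a1, a2, a3.trans hlt.le⟩
    linarith

/-- The load of a processor by the tasks of consecutive levels, where the level of index `n` of the
bucket `ℓ` has number `ℓ * M + n`. -/
theorem load_le_of_rounding [Fintype P] [Fintype T] {α δ : ℝ} {s : LPSolution P J T}
    (h : I.LPFeasible δ s) (hδ : 0 < δ) (hα : 1 < α) {f : T → P}
    (hf : ∀ ℓ n, IsShmoysTardosRounding I.p (I.fracAssign δ s ℓ) (I.level α δ s ℓ n) f)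
    {b n : T → ℕ} (hbn : ∀ k ℓ m, k ∈ I.level α δ s ℓ m ↔ b k = ℓ ∧ n k = m) {M : ℕ}
    (hM : ∀ k, n k < M) (i : P) (u v ℓ : ℕ) (hℓ : 1 ≤ ℓ) (hv : v ≤ (ℓ + 1) * M) :
    ∑ k with f k = i ∧ b k * M + n k ∈ Ico u v, I.p i k ≤
      α / (α - 1) * (1 + δ) ^ ℓ + ∑ m ∈ Ico u v, (1 + δ) ^ (m / M) := by
  set key : T → ℕ := fun k => b k * M + n k with hkey
  have hdiv : ∀ k, key k / M = b k := fun k => by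
    have := hM k
    rw [hkey]
    simp only
    rw [mul_comm, Nat.mul_add_div (by omega), Nat.div_eq_of_lt this, add_zero]
  have hmod : ∀ k, key k % M = n k := fun k => by
    rw [hkey]
    simp only
    rw [mul_comm, Nat.mul_add_mod, Nat.mod_eq_of_lt (hM k)]
  have hlev : ∀ m k, k ∈ I.level α δ s (m / M) (m % M) ↔ key k = m := by
    intro m k
    rw [hbn]
    constructor
    · rintro ⟨h1, h2⟩
      rw [hkey]
      simp only
      rw [h1, h2, mul_comm, Nat.div_add_mod]
    · rintro rfl
      exact ⟨(hdiv k).symm, (hmod k).symm⟩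
  have hmem : ∀ k, k ∈ I.level α δ s (b k) (n k) := fun k => (hbn k _ _).2 ⟨rfl, rfl⟩
  calc ∑ k with f k = i ∧ key k ∈ Ico u v, I.p i k
      = ∑ m ∈ Ico u v, ∑ k with k ∈ I.level α δ s (m / M) (m % M) ∧ f k = i, I.p i k := by
        rw [← sum_fiberwise_of_maps_to (t := Ico u v) (g := key) fun k hk => (mem_filter.1 hk).2.2]
        refine sum_congr rfl fun m hm => ?_
        rw [filter_filter]
        refine sum_congr ?_ fun _ _ => rfl
        ext k
        simp only [mem_filter, mem_univ, true_and, hlev]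
        constructor
        · rintro ⟨⟨h1, _⟩, h2⟩
          exact ⟨h2, h1⟩
        · rintro ⟨rfl, h1⟩
          exact ⟨⟨h1, hm⟩, rfl⟩
    -- Rounding is paid level by level; positive fractions occur only for processing times at most
    -- `(1+δ)^(m / M)`.
    _ ≤ ∑ m ∈ Ico u v, (∑ k with k ∈ I.level α δ s (m / M) (m % M),
          I.p i k * I.fracAssign δ s (m / M) i k + (1 + δ) ^ (m / M)) :=
        sum_le_sum fun m _ => (hf (m / M) (m % M)).load_le i
          (fun k _ => h.fracAssign_nonneg _ i k) (fun k _ => (I.p_pos i k).le) _ (by positivity)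
          fun k _ => h.p_le_of_fracAssign_pos hδ
    _ = ∑ k with key k ∈ Ico u v, I.p i k * I.fracAssign δ s (b k) i k +
          ∑ m ∈ Ico u v, (1 + δ) ^ (m / M) := by
        rw [sum_add_distrib]
        congr 1
        rw [← sum_fiberwise_of_maps_to (t := Ico u v) (g := key) fun k hk => (mem_filter.1 hk).2]
        refine sum_congr rfl fun m hm => ?_
        rw [filter_filter]
        refine sum_congr ?_ fun k hk => ?_
        · ext k
          simp only [mem_filter, mem_univ, true_and, hlev]
          exact ⟨fun h1 => ⟨h1 ▸ hm, h1⟩, fun h1 => h1.2⟩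
        · rw [← hdiv k, (mem_filter.1 hk).2.2]
    _ ≤ _ := by
        refine add_le_add_left (le_trans ?_ (h.sum_p_mul_fracAssign_le hδ hα
          (fun k => I.mem_bucket_of_mem_level (hmem k)) i hℓ)) _
        refine sum_le_sum_of_subset_of_nonneg (fun k hk => ?_) fun k _ _ =>
          mul_nonneg (I.p_pos i k).le (h.fracAssign_nonneg _ i k)
        simp only [mem_filter, mem_univ, true_and, mem_Ico] at hk ⊢
        rw [← hdiv k]
        exact Nat.le_of_lt_succ (Nat.div_lt_of_lt_mul (by
          rw [mul_comm]; exact hk.2.trans_le hv))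

/-- Induction along the chain of delaying predecessors. The first term counts how often each bucket
is charged for fractional load; the second is the rounding loss of all levels up to that of `k`,
each taken once. -/
theorem IsOutput.completion_le [Fintype P] [Fintype J] [Nonempty J] [Fintype T] {α δ : ℝ}
    {s : LPSolution P J T} (h : I.LPFeasible δ s) (hδ : 0 < δ) (hα : 1 < α) {σ : Schedule P T}
    (hσ : I.IsOutput α δ s σ) {b n : T → ℕ}
    (hbn : ∀ k ℓ m, k ∈ I.level α δ s ℓ m ↔ b k = ℓ ∧ n k = m) (k : T) :
    I.completion σ k ≤ α / (α - 1) * (I.lmax * ∑ ℓ ∈ Ico 1 (b k), (1 + δ) ^ ℓ +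
        (n k + 1) * (1 + δ) ^ b k) +
      ∑ m ∈ Ico (I.lmax + 1) (b k * (I.lmax + 1) + n k + 1), (1 + δ) ^ (m / (I.lmax + 1)) := by
  obtain ⟨hround, ord, -, hord, hleast⟩ := hσ
  set M := I.lmax + 1 with hMdef
  set A := α / (α - 1) with hAdef
  have hA : 0 ≤ A := div_nonneg (by linarith) (by linarith)
  have hlev : ∀ k, k ∈ I.level α δ s (b k) (n k) := fun k => (hbn k _ _).2 ⟨rfl, rfl⟩
  have hb1 : ∀ k, 1 ≤ b k := fun k => (I.mem_bucket_of_mem_level (hlev k)).1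
  have hnh : ∀ k, n k ≤ I.height k := fun k => I.le_height_of_mem_remaining _ _ k (hlev k).1
  have hnM : ∀ k, n k < M := fun k => Nat.lt_succ_of_le ((hnh k).trans (I.height_le_lmax k))
  have hkey : ∀ k₀ k, ord k₀ ≤ ord k → b k₀ * M + n k₀ ≤ b k * M + n k := by
    intro k₀ k hk
    by_contra! hlt
    have hcmp : ¬ (b k < b k₀ ∨ b k = b k₀ ∧ n k < n k₀) := fun hc =>
      (hord _ _ _ _ k (hlev k) k₀ (hlev k₀) hc).not_ge hk
    rcases lt_trichotomy (b k₀) (b k) with hb | hb | hb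
    · have := Nat.mul_le_mul_right M hb
      rw [Nat.succ_mul] at this
      have := hnM k₀
      omega
    · rw [hb] at hlt
      exact hcmp (Or.inr ⟨hb.symm, by omega⟩)
    · exact hcmp (Or.inl hb)
  have hload : ∀ k₀ k u, ord k₀ ≤ ord k → u ≤ b k₀ * M + n k₀ →
      ∑ k' with σ.proc k' = σ.proc k ∧ ord k₀ ≤ ord k' ∧ ord k' ≤ ord k, I.p (σ.proc k) k' ≤
        A * (1 + δ) ^ b k + ∑ m ∈ Ico u (b k * M + n k + 1), (1 + δ) ^ (m / M) := by
    intro k₀ k u hk hu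
    refine le_trans (sum_le_sum_of_subset_of_nonneg (fun k' hk' => ?_)
      fun k' _ _ => (I.p_pos _ k').le) (load_le_of_rounding h hδ hα hround hbn hnM (σ.proc k) u
        (b k * M + n k + 1) (b k) (hb1 k) ?_)
    · simp only [mem_filter, mem_univ, true_and, mem_Ico] at hk' ⊢
      exact ⟨hk'.1, hu.trans (hkey k₀ k' hk'.2.1), Nat.lt_succ_of_le (hkey k' k hk'.2.2)⟩
    · have := hnM k
      rw [Nat.succ_mul]
      omega
  induction hn : ord k using Nat.strong_induction_on generalizing k with
  | _ o ih =>
  subst hn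
  have hq : ∀ ℓ : ℕ, 0 ≤ (1 + δ) ^ ℓ := fun ℓ => by positivity
  obtain ⟨k₀, -, hk₀, c, hc, hle⟩ := exists_completion_le hleast (σ.proc k) k rfl
  rcases hc with rfl | ⟨k₁, hprec, rfl⟩
  -- `M` is the number of the first level of bucket 1, the earliest that can contain a task.
  · have h1 := hload k₀ k M hk₀ ((Nat.le_mul_of_pos_left M (hb1 k₀)).trans (Nat.le_add_right _ _))
    have h2 : A * (1 + δ) ^ b k ≤ A * (I.lmax * ∑ ℓ ∈ Ico 1 (b k), (1 + δ) ^ ℓ +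
        (n k + 1) * (1 + δ) ^ b k) := by
      refine mul_le_mul_of_nonneg_left ?_ hA
      have h3 : 0 ≤ (I.lmax : ℝ) * ∑ ℓ ∈ Ico 1 (b k), (1 + δ) ^ ℓ :=
        mul_nonneg (Nat.cast_nonneg _) (Finset.sum_nonneg fun ℓ _ => hq ℓ)
      have h4 : 0 ≤ (n k : ℝ) * (1 + δ) ^ b k := mul_nonneg (Nat.cast_nonneg _) (hq _)
      linarith
    linarith
  · have hb : b k₁ ≤ b k₀ := bucket_index_mono (by linarith) hδ
      (I.mem_bucket_of_mem_level (hlev k₁)) (I.mem_bucket_of_mem_level (hlev k₀))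
      (h.Ctask_le_of_prec hprec)
    have hlex : b k₁ < b k₀ ∨ b k₁ = b k₀ ∧ n k₁ < n k₀ := by
      rcases hb.lt_or_eq with hb | hb
      · exact Or.inl hb
      · refine Or.inr ⟨hb, decompose_index_lt (hlev k₁) ?_ hprec⟩
        rw [hb]
        exact hlev k₀
    have hord₁ : ord k₁ < ord k₀ := hord _ _ _ _ k₁ (hlev k₁) k₀ (hlev k₀) hlex
    have hkey₁ : b k₁ * M + n k₁ + 1 ≤ b k₀ * M + n k₀ := by
      rcases hlex with hlt | ⟨h1, h2⟩
      · have := Nat.mul_le_mul_right M hlt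
        rw [Nat.succ_mul] at this
        have := hnM k₁
        omega
      · rw [h1]; omega
    have hkey₀ := hkey k₀ k hk₀
    -- Having a successor, `k₁` is not at maximal height. This gives the coefficient `lmax`, not
    -- `lmax + 1`, for the earlier buckets.
    have hn₁ : n k₁ + 1 ≤ I.lmax := by
      have h1 := hnh k₁
      have h2 := I.height_le_lmax k₀
      rw [hprec.height_eq] at h2
      omega
    have h1 := ih (ord k₁) (hord₁.trans_le hk₀) k₁ rfl
    have h2 := hload k₀ k _ hk₀ hkey₁
    have h3 := sum_Ico_consecutive (fun m => (1 + δ) ^ (m / M))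
      (show M ≤ b k₁ * M + n k₁ + 1 by
        have := Nat.le_mul_of_pos_left M (hb1 k₁)
        omega)
      (show b k₁ * M + n k₁ + 1 ≤ b k * M + n k + 1 by omega)
    -- The new charge fits: if `k₁` lies in an earlier bucket, its `n k₁ + 1` charges are absorbed
    -- by `lmax`; in the same bucket its level is strictly smaller.
    have h4 : (I.lmax * ∑ ℓ ∈ Ico 1 (b k₁), (1 + δ) ^ ℓ + (n k₁ + 1) * (1 + δ) ^ b k₁) +
        (1 + δ) ^ b k ≤ I.lmax * ∑ ℓ ∈ Ico 1 (b k), (1 + δ) ^ ℓ + (n k + 1) * (1 + δ) ^ b k := by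
      rcases lt_trichotomy (b k₁) (b k) with hlt | heq | hgt
      · have h5 : ((n k₁ : ℝ) + 1) * (1 + δ) ^ b k₁ ≤ I.lmax * (1 + δ) ^ b k₁ :=
          mul_le_mul_of_nonneg_right (by exact_mod_cast hn₁) (hq _)
        have h6 : ∑ ℓ ∈ Ico 1 (b k₁ + 1), (1 + δ) ^ ℓ ≤ ∑ ℓ ∈ Ico 1 (b k), (1 + δ) ^ ℓ :=
          sum_le_sum_of_subset_of_nonneg (Ico_subset_Ico_right hlt) fun ℓ _ _ => hq ℓ
        rw [sum_Ico_succ_top (hb1 k₁)] at h6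
        have h7 := mul_le_mul_of_nonneg_left h6 (Nat.cast_nonneg I.lmax : (0 : ℝ) ≤ _)
        have h8 : 0 ≤ (n k : ℝ) * (1 + δ) ^ b k := mul_nonneg (Nat.cast_nonneg _) (hq _)
        linarith
      · rw [heq] at hkey₁ ⊢
        have h5 : ((n k₁ : ℝ) + 1) * (1 + δ) ^ b k ≤ n k * (1 + δ) ^ b k := by
          refine mul_le_mul_of_nonneg_right ?_ (hq _)
          have : n k₁ + 1 ≤ n k := by omega
          exact_mod_cast this
        linarith
      · have := Nat.mul_le_mul_right M hgt
        rw [Nat.succ_mul] at this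
        have := hnM k
        omega
    have h5 := mul_le_mul_of_nonneg_left h4 hA
    rw [mul_add A (_ + _)] at h5
    linarith

theorem IsOutput.completion_le_ratio [Fintype P] [Fintype J] [Nonempty J] [Fintype T] {α δ : ℝ}
    {s : LPSolution P J T} (h : I.LPFeasible δ s) (hδ : 0 < δ) (hα : 1 < α) {σ : Schedule P T}
    (hσ : I.IsOutput α δ s σ) (k : T) :
    I.completion σ k ≤ ratio α δ I.lmax * s.Ctask k := by
  obtain ⟨b, n, hbn⟩ := I.exists_level_indices hα.le hδ (h.one_le_Ctask hδ)
  have hlev : k ∈ I.level α δ s (b k) (n k) := (hbn k _ _).2 ⟨rfl, rfl⟩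
  have hbk := I.mem_bucket_of_mem_level hlev
  have hn : n k ≤ I.lmax :=
    (I.le_height_of_mem_remaining _ _ k hlev.1).trans (I.height_le_lmax k)
  have h1 := hσ.completion_le h hδ hα hbn k
  have hα1 : 0 < α - 1 := by linarith
  have hA : 0 ≤ α / (α - 1) := by positivity
  have h2 : ∑ m ∈ Ico (I.lmax + 1) (b k * (I.lmax + 1) + n k + 1), (1 + δ) ^ (m / (I.lmax + 1)) ≤
      (I.lmax + 1 : ℕ) * ∑ t ∈ Ico 1 (b k + 1), (1 + δ) ^ t := by
    rw [← sum_Ico_pow_div]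
    refine sum_le_sum_of_subset_of_nonneg (Ico_subset_Ico_right ?_) fun m _ _ => by positivity
    rw [Nat.succ_mul]
    omega
  rw [sum_Ico_succ_top hbk.1] at h2
  push_cast at h2
  set l : ℝ := ((I.lmax : ℕ) : ℝ)
  have hl : 0 ≤ l := Nat.cast_nonneg _
  set G := ∑ t ∈ Ico 1 (b k), (1 + δ) ^ t
  set Q := (1 + δ) ^ b k with hQ
  have hG : G ≤ Q / δ := (le_div_iff₀' hδ).2 (mul_sum_Ico_pow_le hδ (b k))
  have hQ0 : 0 ≤ Q := by positivity
  -- The upper end of the bucket exceeds its lower end by a factor `1 + δ`, which produces the last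
  -- factor of the ratio.
  have hQC : Q ≤ (1 + δ) * (α * s.Ctask k) := by
    rw [hQ, ← Nat.sub_add_cancel hbk.1, pow_succ']
    exact mul_le_mul_of_nonneg_left hbk.2.1 (by linarith)
  have h3 : α / (α - 1) * (l * G + (n k + 1) * Q) ≤ α / (α - 1) * (l * (Q / δ) + (l + 1) * Q) := by
    have : (n k : ℝ) ≤ l := Nat.cast_le.2 hn
    gcongr
  have h4 : (l + 1) * (G + Q) ≤ (l + 1) * (Q / δ + Q) := by gcongr
  have hR : 0 ≤ (l + 1) * (α / (α - 1)) + l * (α / (δ * (α - 1))) + l + 1 + (l + 1) / δ := by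
    positivity
  calc I.completion σ k
      ≤ α / (α - 1) * (l * (Q / δ) + (l + 1) * Q) + (l + 1) * (Q / δ + Q) := by linarith
    _ = ((l + 1) * (α / (α - 1)) + l * (α / (δ * (α - 1))) + l + 1 + (l + 1) / δ) * Q := by
        field_simp
        ring
    _ ≤ _ := mul_le_mul_of_nonneg_left hQC hR
    _ = _ := by rw [ratio]; ring

end Instance

/-! ### Growth of the ratio and conclusion -/

theorem ratio_nonneg {α δ l : ℝ} (hα : 1 < α) (hδ : 0 < δ) (hl : 0 ≤ l) : 0 ≤ ratio α δ l := by
  have : 0 < α - 1 := by linarith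
  unfold ratio
  positivity

/-- The ratio is affine in `l` with nonnegative value at 0. -/
theorem ratio_le {α δ l : ℝ} (hα : 1 < α) (hδ : 0 < δ) (hl : 1 ≤ l) :
    ratio α δ l ≤ ratio α δ 1 * l := by
  have h1 : ratio α δ l = ratio α δ 1 * l - ratio α δ 0 * (l - 1) := by
    unfold ratio
    ring
  have h2 := mul_nonneg (ratio_nonneg hα hδ le_rfl) (sub_nonneg.2 hl)
  linarith

end MapReduce

theorem mainTheorem1 (α δ : ℝ) (hα : 1 < α) (hδ : 0 < δ) :
    ∃ K : ℝ, 0 < K ∧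
      ∀ (P J T : Type*) [Fintype P] [Nonempty P] [Fintype J] [Nonempty J] [Fintype T]
        (I : MapReduce.Instance P J T),
        (∃ s, I.LPOptimal δ s) ∧
        (∀ s, I.LPOptimal δ s →
          (∃ σ, I.IsOutput α δ s σ) ∧
          ∀ σ, I.IsOutput α δ s σ →
            I.Feasible σ ∧
            ∀ σ', I.Feasible σ' →
              I.cost σ ≤ MapReduce.ratio α δ I.lmax * I.cost σ') ∧
        I.lmax + 1 = 2 * I.rmax ∧
        MapReduce.ratio α δ I.lmax ≤ K * I.lmax ∧
        MapReduce.ratio α δ I.lmax ≤ K * I.rmax := by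
  have hα1 : 0 < α - 1 := by linarith
  have hρ : 0 < MapReduce.ratio α δ 1 := by
    unfold MapReduce.ratio
    positivity
  -- The factor 2 comes from `lmax ≤ 2 * rmax`.
  refine ⟨2 * MapReduce.ratio α δ 1, by linarith, ?_⟩
  intro P J T _ _ _ _ _ I
  have hlr := I.lmax_add_one
  have hr := I.one_le_rmax
  have hl1 : (1 : ℝ) ≤ I.lmax := by exact_mod_cast (show 1 ≤ I.lmax by omega)
  have hl2 : (I.lmax : ℝ) ≤ 2 * I.rmax := by exact_mod_cast (show I.lmax ≤ 2 * I.rmax by omega)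
  have hle := MapReduce.ratio_le hα hδ hl1
  refine ⟨I.exists_lpOptimal hδ, fun s hs => ⟨hs.1.exists_isOutput hδ hα, fun σ hσ =>
    ⟨hσ.feasible, fun σ' hσ' => ?_⟩⟩, hlr, ?_, ?_⟩
  · have hR := MapReduce.ratio_nonneg hα hδ (zero_le_one.trans hl1)
    obtain ⟨s', hs', hval⟩ := hσ'.exists_lpFeasible hδ
    refine le_trans ?_ (mul_le_mul_of_nonneg_left ((hs.2 s' hs').trans hval) hR)
    rw [MapReduce.Instance.lpValue, Finset.mul_sum]
    refine Finset.sum_le_sum fun j _ => ?_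
    rw [mul_left_comm]
    refine mul_le_mul_of_nonneg_left (I.jobCompletion_le σ j _ fun k hk => ?_) (I.w_nonneg j)
    refine (hσ.completion_le_ratio hs.1 hδ hα k).trans (mul_le_mul_of_nonneg_left ?_ hR)
    rw [← hk]
    exact hs.1.job_ge_task k
  · nlinarith
  · nlinarith
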